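/- **Setting.** Let $K,p,n\ge 1$. A dataset is $\mathcal X=\{(x_i,y_i)\}_{i\in[n]}$ with $x_i\in\mathbb R^p$, $y_i\in[K]$; two datasets are neighbours if they differ in exactly one entry. A randomized algorithm $A$ is $(\epsilon,\delta)$-DP if $P(A(\mathcal X)\in B)\le e^{\epsilon}P(A(\mathcal X')\in B)+\delta$ for all neighbours $\mathcal X,\mathcal X'$ and all measurable $B$. Given $\epsilon,\delta,c_0>0$, $R_x\ge 0$ and a prefixed probability law $\pi_\bot$ on $\mathbb R^K\times(\mathbb R^p)^K$, put $I_k=\{j:y_j=k\}$ and let $\hat\mu_k=|I_k|/n$ and $\hat m_k=|I_k|^{-1}\sum_{j\in I_k}\Pi_{R_x}(x_j)$ (with $\hat m_k=0$ if $I_k=\emptyset$), where $\Pi_R(x)=\frac{R}{\|x\|\vee R}x$. Put $$\gamma(\mathcal X)=\Big(\min_k|I_k|-c_0n-1\Big)_+,\quad \alpha=\frac2n\sqrt{\frac{2R_x^2}{c_0^2}+2},\quad M=1+\frac2\epsilon\log\max\Big\{\frac1\delta,\frac1\epsilon\Big\},\quad \pi(\mathcal X)=\frac{e^{\epsilon(\gamma(\mathcal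 X)-M)/2}}{e^{\epsilon(\gamma(\mathcal X)-M)/2}+1}.$$ The ePTR Bayes classifier first outputs $(\hat\mu_{[K]},\hat m_{[K]})+\frac{2\alpha}{\epsilon}\sqrt{2\log(1.25/\delta)}\,\zeta$, with $\zeta$ standard Gaussian on $\mathbb R^K\times(\mathbb R^p)^K$, with probability $\pi(\mathcal X)$, and a sample $\bot\sim\pi_\bot$ with probability $1-\pi(\mathcal X)$. It then replaces the component $(\mu_k)_k$ of this output by $\big((\mu_k\vee c_0)/\sum_j(\mu_j\vee c_0)\big)_k$. The result is $(\tilde\mu_k,\tilde m_k)_{k\in[K]}$. **Theorem.** 1. If $0<\epsilon\le 2$, $\delta>0$, $c_0>0$, $R_x\ge0$, then $(\tilde\mu_k,\tilde m_k)_{k\in[K]}$ is $(\epsilon,\delta)$-DP. 2. For all $c_0>0$, $C_m\ge1$, $C_\bot\ge 0$ there is a constant $C>0$, depending only on $c_0,C_m,C_\bot$, with the following property. Let $\epsilon>0$, and let the $(x_i,y_i)$, $i\in[n]$, be i.i.d. with $P(y_i=k)=\mu_k$ and $x_i\mid y_i=k\sim\mathcal N(m_k,I_p)$, where $\min_k\mu_k>2c_0$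 and $\|m_k\|\le C_m\sqrt p$ for all $k$. Let $0<\delta<n^{-3}$, $R_x=4C_m\sqrt{p\,|\log n|}$, $n\ge\frac4{c_0}+\frac8{c_0\epsilon}\log\frac1\delta$, and suppose that $\|\bot-(\mu_{[K]},m_{[K]})\|^2\le C_\bot\,p$ almost surely under $\pi_\bot$. Then $$\mathbb E\sum_{k=1}^K\big(|\tilde\mu_k-\mu_k|^2+\|\tilde m_k-m_k\|^2\big)\le C\left(\frac pn+\frac{p^2\log n\,\log(1/\delta)}{\epsilon^2n^2}\right).$$ -/

import Mathlib

open MeasureTheory ProbabilityTheory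

noncomputable section

/-! ### Differential privacy -/

/-- Two datasets of size `n` are neighbours if they differ in exactly one entry. -/
def Neighbors {n : ℕ} {Z : Type*} (X X' : Fin n → Z) : Prop :=
  ∃! i, X i ≠ X' i

/-- A randomized algorithm, given by the law `A X` of its output on each dataset `X`, is
`(ε, δ)`-differentially private. -/
def IsDP {n : ℕ} {Z O : Type*} [MeasurableSpace O] (ε δ : ℝ) (A : (Fin n → Z) → Measure O) :
    Prop :=
  ∀ X X' : Fin n → Z, Neighbors X X' → ∀ B : Set O, MeasurableSet B →
    A X B ≤ ENNReal.ofReal (Real.exp ε) * A X' B + ENNReal.ofReal δ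

/-! ### Efficient propose-test-release (ePTR) -/

/-- The threshold `M = 1 + (2/ε) log (max {1/δ, 1/ε})`. -/
def ePTRThreshold (ε δ : ℝ) : ℝ :=
  1 + 2 / ε * Real.log (max (1 / δ) (1 / ε))

/-- The release probability when the sub-distance equals `g`. -/
def ePTRReleaseProb (ε δ g : ℝ) : ℝ :=
  Real.exp (ε * (g - ePTRThreshold ε δ) / 2) /
    (Real.exp (ε * (g - ePTRThreshold ε δ) / 2) + 1)

/-- The law of `θ̂ + (2α/ε) √(2 log (1.25/δ)) ζ` with `ζ` standard Gaussian in `E`. -/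
def gaussianRelease {E : Type*} [NormedAddCommGroup E] [InnerProductSpace ℝ E]
    [FiniteDimensional ℝ E] [MeasurableSpace E] [BorelSpace E]
    (ε δ α : ℝ) (θhat : E) : Measure E :=
  (stdGaussian E).map
    (fun ζ => θhat + (2 * α / ε * Real.sqrt (2 * Real.log (1.25 / δ))) • ζ)

/-- The law of the ePTR output: with the release probability the noisy estimate is released,
otherwise the output is a sample of the prefixed law `bot`. Here `θhat` is the estimate, `g` the
sub-distance of the dataset, and `α` the proposed local sensitivity. -/
def ePTRLaw {E : Type*} [NormedAddCommGroup E] [InnerProductSpace ℝ E]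
    [FiniteDimensional ℝ E] [MeasurableSpace E] [BorelSpace E]
    (ε δ α : ℝ) (bot : Measure E) (θhat : E) (g : ℝ) : Measure E :=
  ENNReal.ofReal (ePTRReleaseProb ε δ g) • gaussianRelease ε δ α θhat +
    ENNReal.ofReal (1 - ePTRReleaseProb ε δ g) • bot

/-! ### The Bayes classifier -/

/-- A labelled data point `(x, y)` with `x ∈ ℝ^p` and `y` one of `K` classes. -/
abbrev LabelledPoint (K p : ℕ) : Type :=
  EuclideanSpace ℝ (Fin p) × Fin K

/-- The Euclidean space `ℝ^K × (ℝ^p)^K` of parameters `(μ_1, …, μ_K, m_1, …, m_K)`. -/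
abbrev BayesParam (K p : ℕ) : Type :=
  WithLp 2 (EuclideanSpace ℝ (Fin K) × PiLp 2 (fun _ : Fin K => EuclideanSpace ℝ (Fin p)))

/-- The parameter with class probabilities `μ` and class means `m`. -/
def bayesParam {K p : ℕ} (μ : Fin K → ℝ) (m : Fin K → EuclideanSpace ℝ (Fin p)) :
    BayesParam K p :=
  WithLp.toLp 2 (WithLp.toLp 2 μ, WithLp.toLp 2 m)

/-- The squared error `∑ₖ (|μ̃ₖ - μₖ|² + ‖m̃ₖ - mₖ‖²)` of the estimate `t = (μ̃, m̃)`. -/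
def bayesSqError {K p : ℕ} (μ : Fin K → ℝ) (m : Fin K → EuclideanSpace ℝ (Fin p))
    (t : BayesParam K p) : ℝ :=
  ∑ k, (|t.fst k - μ k| ^ 2 + ‖t.snd k - m k‖ ^ 2)

/-- The projection of `x` onto the centred ball of radius `R`. -/
def ballProj {E : Type*} [NormedAddCommGroup E] [NormedSpace ℝ E] (R : ℝ) (x : E) : E :=
  (R / max ‖x‖ R) • x

/-- The index set `I_k` of the data points with label `k`. -/
def classIndices {K p n : ℕ} (X : Fin n → LabelledPoint K p) (k : Fin K) : Finset (Fin n) :=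
  {j | (X j).2 = k}

/-- The sample frequencies `|I_k| / n`. -/
def sampleFreq {K p n : ℕ} (X : Fin n → LabelledPoint K p) (k : Fin K) : ℝ :=
  ((classIndices X k).card : ℝ) / n

/-- The class sample means of the projected features (equal to `0` for an empty class). -/
def sampleMean {K p n : ℕ} (R : ℝ) (X : Fin n → LabelledPoint K p) (k : Fin K) :
    EuclideanSpace ℝ (Fin p) :=
  ((classIndices X k).card : ℝ)⁻¹ • ∑ j ∈ classIndices X k, ballProj R (X j).1

/-- The sub-distance `γ(X) = (min_k |I_k| - c₀ n - 1)₊`. -/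
def bayesSubDist {K p n : ℕ} (c₀ : ℝ) (X : Fin n → LabelledPoint K p) : ℝ :=
  max ((⨅ k : Fin K, ((classIndices X k).card : ℝ)) - c₀ * n - 1) 0

/-- The local sensitivity level `α = (2/n) √(2 R² / c₀² + 2)`. -/
def bayesSensitivity (n : ℕ) (R c₀ : ℝ) : ℝ :=
  2 / n * Real.sqrt (2 * R ^ 2 / c₀ ^ 2 + 2)

/-- The final augmentation: the class probabilities are clipped from below at `c₀` and
normalized; the class means are not changed. -/
def bayesAugment {K p : ℕ} (c₀ : ℝ) (t : BayesParam K p) : BayesParam K p :=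
  bayesParam (fun k => max (t.fst k) c₀ / ∑ j, max (t.fst j) c₀) (fun k => t.snd k)

/-- The law of the output `(μ̃, m̃)` of the ePTR Bayes classifier on the dataset `X`. -/
def bayesEPTR {K p n : ℕ} (ε δ R c₀ : ℝ) (bot : Measure (BayesParam K p))
    (X : Fin n → LabelledPoint K p) : Measure (BayesParam K p) :=
  (ePTRLaw ε δ (bayesSensitivity n R c₀) bot
    (bayesParam (sampleFreq X) (sampleMean R X)) (bayesSubDist c₀ X)).map (bayesAugment c₀)

/-! ### The data generating process and the risk -/

/-- The law of one data point: `P(y = k) = μ k` and `x` given `y = k` is `N(m k, I)`. -/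
def bayesPointLaw {K p : ℕ} (μ : Fin K → ℝ) (m : Fin K → EuclideanSpace ℝ (Fin p)) :
    Measure (LabelledPoint K p) :=
  ∑ k, ENNReal.ofReal (μ k) • (multivariateGaussian (m k) 1).prod (Measure.dirac k)

/-- The mean squared error of the ePTR Bayes classifier on `n` i.i.d. data points: the
expectation over the data and over the internal randomness of the algorithm. -/
def bayesMSE {K p : ℕ} (n : ℕ) (ε δ R c₀ : ℝ) (bot : Measure (BayesParam K p))
    (μ : Fin K → ℝ) (m : Fin K → EuclideanSpace ℝ (Fin p)) : ENNReal :=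
  ∫⁻ X : Fin n → LabelledPoint K p,
    (∫⁻ t, ENNReal.ofReal (bayesSqError μ m t) ∂(bayesEPTR ε δ R c₀ bot X))
    ∂(Measure.pi fun _ : Fin n => bayesPointLaw μ m)

end

/-! Privacy. The budget `ε` is spent in two halves. Changing one entry moves `bayesSubDist` by at
most 1, so the logistic release probability and its complement each change by a factor of at most
`exp (ε / 2)`. If the sub-distance is zero, release has probability at most `δ` and is absorbed by
the additive term. If it is positive, every class keeps at least `c₀ n` points once the changed
entry is removed, so the estimate moves by at most `bayesSensitivity` (`norm_bayesParam_sub_le`),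
and the Gaussian noise costs the other `exp (ε / 2)` and a `δ` (`gaussianRelease_le`). The
augmentation is post-processing.

Risk. The error is bounded pointwise in the data by statistics with explicit second moments, so the
labels are never conditioned on (`conditional_risk_le`). Squared count deviations control the
frequencies and, as in Chebyshev's inequality, the probability of the fallback. The centred class
sums of `ballProj R x - m k` control the means: either every class has more than `c₀ n` points, or
release has probability at most `δ`, which beats the crude error bound. These sums have second
moment of order `n p`, because projection costs only order `p / n` in mean square
(`integral_norm_ballProj_sub_sq_le`). The noise enters in `K + K p` coordinates and gives the second
term of the rate; `K ≤ 1 / c₀` keeps `K` out of the constant. The augmentation inflates the error by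
a constant factor only (`bayesSqError_bayesAugment_le`). -/

open scoped RealInnerProductSpace

/-! ### Translates of the standard Gaussian measure. -/

section GaussianShift

variable {E : Type*} [NormedAddCommGroup E] [InnerProductSpace ℝ E] [FiniteDimensional ℝ E]
  [MeasurableSpace E] [BorelSpace E]

theorem map_inner_stdGaussian (v : E) :
    (stdGaussian E).map (fun x => ⟪v, x⟫) = gaussianReal 0 (‖v‖ ^ 2).toNNReal := by
  have h := IsGaussian.map_eq_gaussianReal (μ := stdGaussian E) (innerSL ℝ v)
  rw [integral_strongDual_stdGaussian, variance_dual_stdGaussian, innerSL_apply_norm] at h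
  exact h

theorem integrable_exp_inner_stdGaussian (v : E) :
    Integrable (fun x => Real.exp ⟪v, x⟫) (stdGaussian E) := by
  have h := integrable_exp_mul_gaussianReal (μ := 0) (v := (‖v‖ ^ 2).toNNReal) 1
  rw [← map_inner_stdGaussian v] at h
  have := h.comp_measurable (by fun_prop)
  simpa [Function.comp_def] using this

/-- The Gaussian transform at the complex vector `v + i t`, whose bilinear square is `‖v‖² - ‖t‖² +
2i⟪v, t⟫`. Orthonormal coordinates reduce it to the one-dimensional complex moment generating
function. -/
theorem integral_cexp_inner_stdGaussian (v t : E) :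
    ∫ x, Complex.exp (⟪v, x⟫ + ⟪t, x⟫ * Complex.I) ∂(stdGaussian E) =
      Complex.exp ((‖v‖ ^ 2 - ‖t‖ ^ 2) / 2 + ⟪v, t⟫ * Complex.I) := by
  set b := stdOrthonormalBasis ℝ E
  have hz : ∀ z : ℂ, ∫ x, Complex.exp (z * (x : ℝ)) ∂(gaussianReal 0 1) =
      Complex.exp (z ^ 2 / 2) := by
    intro z
    have := complexMGF_id_gaussianReal (μ := 0) (v := 1) z
    simpa [complexMGF] using this
  have he : ∀ x : Fin (Module.finrank ℝ E) → ℝ,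
      Complex.exp (⟪v, ∑ i, x i • b i⟫ + ⟪t, ∑ i, x i • b i⟫ * Complex.I) =
        ∏ i, Complex.exp (((⟪v, b i⟫ : ℝ) + (⟪t, b i⟫ : ℝ) * Complex.I) * (x i : ℝ)) := by
    intro x
    rw [← Complex.exp_sum]
    congr 1
    simp_rw [inner_sum, real_inner_smul_right]
    push_cast
    rw [Finset.sum_mul, ← Finset.sum_add_distrib]
    exact Finset.sum_congr rfl fun i _ => by ring
  rw [stdGaussian, integral_map (Measurable.aemeasurable (by fun_prop))
    (Measurable.aestronglyMeasurable (by fun_prop))]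
  simp_rw [show stdOrthonormalBasis ℝ E = b from rfl, he]
  rw [integral_fintype_prod_eq_prod (f := fun i (x : ℝ) =>
    Complex.exp (((⟪v, b i⟫ : ℝ) + (⟪t, b i⟫ : ℝ) * Complex.I) * x))]
  simp_rw [hz]
  rw [← Complex.exp_sum]
  congr 1
  have h1 : (‖v‖ : ℂ) ^ 2 = ∑ i, (⟪v, b i⟫ : ℂ) ^ 2 := by
    rw [← Complex.ofReal_pow, ← b.sum_sq_inner_left v]; push_cast; rfl
  have h2 : (‖t‖ : ℂ) ^ 2 = ∑ i, (⟪t, b i⟫ : ℂ) ^ 2 := by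
    rw [← Complex.ofReal_pow, ← b.sum_sq_inner_left t]; push_cast; rfl
  have h3 : (⟪v, t⟫ : ℂ) = ∑ i, (⟪v, b i⟫ : ℂ) * (⟪t, b i⟫ : ℂ) := by
    rw [← b.sum_inner_mul_inner v t]; push_cast
    exact Finset.sum_congr rfl fun i _ => by rw [real_inner_comm t]
  rw [h1, h2, h3, ← Finset.sum_sub_distrib, Finset.sum_div, Finset.sum_mul,
    ← Finset.sum_add_distrib]
  refine Finset.sum_congr rfl fun i _ => ?_
  ring_nf
  rw [Complex.I_sq]
  ring

/-- The Cameron–Martin formula for the standard Gaussian measure. -/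
theorem stdGaussian_map_const_add (v : E) :
    (stdGaussian E).map (fun x => v + x) =
      (stdGaussian E).withDensity
        (fun x => ENNReal.ofReal (Real.exp (⟪v, x⟫ - ‖v‖ ^ 2 / 2))) := by
  have hint : Integrable (fun x => Real.exp (⟪v, x⟫ - ‖v‖ ^ 2 / 2)) (stdGaussian E) := by
    simp_rw [Real.exp_sub]
    exact (integrable_exp_inner_stdGaussian v).div_const _
  have hfin : IsFiniteMeasure ((stdGaussian E).withDensity
      (fun x => ENNReal.ofReal (Real.exp (⟪v, x⟫ - ‖v‖ ^ 2 / 2)))) :=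
    isFiniteMeasure_withDensity_ofReal hint.2
  have hfin' : IsFiniteMeasure ((stdGaussian E).map (fun x => v + x)) :=
    Measure.isFiniteMeasure_map _ _
  refine Measure.ext_of_charFun ?_
  ext t
  rw [charFun_map_const_add, charFun_stdGaussian, charFun_apply,
    integral_withDensity_eq_integral_toReal_smul (by fun_prop) (by simp)]
  have he : ∀ x : E, (ENNReal.ofReal (Real.exp (⟪v, x⟫ - ‖v‖ ^ 2 / 2))).toReal •
      Complex.exp (⟪x, t⟫ * Complex.I) =
      Complex.exp (-(‖v‖ ^ 2 / 2)) * Complex.exp (⟪v, x⟫ + ⟪t, x⟫ * Complex.I) := by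
    intro x
    rw [ENNReal.toReal_ofReal (Real.exp_pos _).le, Complex.real_smul, Complex.ofReal_exp,
      ← Complex.exp_add, ← Complex.exp_add, real_inner_comm x t]
    congr 1
    push_cast
    ring
  simp_rw [he]
  rw [integral_const_mul, integral_cexp_inner_stdGaussian, ← Complex.exp_add, ← Complex.exp_add]
  congr 1
  ring

end GaussianShift

/-! ### One-dimensional Gaussian tails. -/

section GaussianTail

theorem gaussianReal_Ioi_zero_le : gaussianReal 0 1 (Set.Ioi 0) ≤ ENNReal.ofReal (1 / 2) := by
  have hs : gaussianReal 0 1 (Set.Iio 0) = gaussianReal 0 1 (Set.Ioi 0) := by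
    have h := gaussianReal_map_neg (μ := 0) (v := 1)
    rw [neg_zero] at h
    conv_lhs => rw [← h]
    rw [Measure.map_apply (by fun_prop) measurableSet_Iio]
    congr 1
    ext x; simp
  have hd : gaussianReal 0 1 (Set.Iio 0) + gaussianReal 0 1 (Set.Ioi 0) ≤ 1 := by
    rw [← measure_union (Set.disjoint_left.2 fun x hx hx' =>
      lt_asymm (Set.mem_Iio.1 hx) (Set.mem_Ioi.1 hx')) measurableSet_Ioi]
    exact prob_le_one
  rw [hs, ← two_mul] at hd
  rw [show (1 / 2 : ℝ) = (2 : ℝ)⁻¹ by norm_num, ENNReal.ofReal_inv_of_pos (by norm_num)]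
  rw [← ENNReal.div_eq_inv_mul.trans (mul_one _)]
  rw [ENNReal.le_div_iff_mul_le (by simp) (by simp), mul_comm]
  simpa using hd

/-- After a shift by `-t` the tail is the half line, where `t x ≥ 0` lets `exp (-t² / 2)` factor out
of the density. The factor `1 / 2` matters later, since `√e > 1.25`. -/
theorem gaussianReal_Ioi_le_of_nonneg {t : ℝ} (ht : 0 ≤ t) :
    gaussianReal 0 1 (Set.Ioi t) ≤ ENNReal.ofReal (Real.exp (-t ^ 2 / 2) / 2) := by
  have h1 : gaussianReal 0 1 (Set.Ioi t) = gaussianReal (-t) 1 (Set.Ioi 0) := by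
    have h := gaussianReal_map_add_const (μ := 0) (v := 1) (-t)
    rw [zero_add] at h
    rw [← h, Measure.map_apply (by fun_prop) measurableSet_Ioi]
    congr 1
    ext x; simp
  rw [h1, gaussianReal_apply _ one_ne_zero]
  calc ∫⁻ x in Set.Ioi 0, gaussianPDF (-t) 1 x
      ≤ ∫⁻ x in Set.Ioi 0, ENNReal.ofReal (Real.exp (-t ^ 2 / 2)) * gaussianPDF 0 1 x := by
        refine setLIntegral_mono' measurableSet_Ioi fun x hx => ?_
        rw [gaussianPDF, gaussianPDF, ← ENNReal.ofReal_mul (Real.exp_pos _).le]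
        refine ENNReal.ofReal_le_ofReal ?_
        rw [gaussianPDFReal, gaussianPDFReal, mul_left_comm, ← Real.exp_add]
        gcongr
        have : 0 < x := hx
        simp only [NNReal.coe_one]
        nlinarith [mul_nonneg ht this.le]
    _ = ENNReal.ofReal (Real.exp (-t ^ 2 / 2)) * gaussianReal 0 1 (Set.Ioi 0) := by
        rw [lintegral_const_mul _ (by fun_prop), gaussianReal_apply _ one_ne_zero]
    _ ≤ ENNReal.ofReal (Real.exp (-t ^ 2 / 2)) * ENNReal.ofReal (1 / 2) := by
        gcongr; exact gaussianReal_Ioi_zero_le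
    _ = _ := by rw [← ENNReal.ofReal_mul (Real.exp_pos _).le]; congr 1; ring

theorem gaussianReal_Ioi_le_of_nonpos {t : ℝ} (ht : t ≤ 0) :
    gaussianReal 0 1 (Set.Ioi t) ≤ ENNReal.ofReal (1 / 2 - t) := by
  have h2 : gaussianReal 0 1 (Set.Ioc t 0) ≤ ENNReal.ofReal (-t) := by
    rw [gaussianReal_apply _ one_ne_zero]
    calc ∫⁻ x in Set.Ioc t 0, gaussianPDF 0 1 x ≤ ∫⁻ x in Set.Ioc t 0, 1 := by
          refine lintegral_mono fun x => ?_
          rw [gaussianPDF, ← ENNReal.ofReal_one]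
          refine ENNReal.ofReal_le_ofReal ?_
          rw [gaussianPDFReal]
          refine mul_le_one₀ ?_ (Real.exp_pos _).le ?_
          · apply inv_le_one_of_one_le₀
            rw [Real.one_le_sqrt]
            have := Real.pi_gt_three
            simp; linarith
          · rw [Real.exp_le_one_iff]
            simp only [sub_zero, NNReal.coe_one]
            nlinarith [sq_nonneg x]
      _ = ENNReal.ofReal (-t) := by simp
  rw [← Set.Ioc_union_Ioi_eq_Ioi ht]
  refine (measure_union_le _ _).trans ?_
  refine (add_le_add h2 gaussianReal_Ioi_zero_le).trans ?_
  rw [← ENNReal.ofReal_add (by linarith) (by norm_num)]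
  exact ENNReal.ofReal_le_ofReal (by linarith)

/-- The tail bound behind the Gaussian mechanism. -/
theorem gaussianReal_Ioi_privacyLoss_le {ε δ : ℝ} (hε : 0 < ε) (hε1 : ε ≤ 1) (hδ : 0 < δ)
    (hδ1 : δ < 1) {c : ℝ} (hc : c = Real.sqrt (2 * Real.log (1.25 / δ))) :
    gaussianReal 0 1 (Set.Ioi (c - ε / (2 * c))) ≤ ENNReal.ofReal δ := by
  have hlog : (1 / 5 : ℝ) ≤ Real.log (1.25 / δ) := by
    have h1 : Real.log 1.25 ≤ Real.log (1.25 / δ) := by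
      apply Real.log_le_log (by norm_num)
      rw [le_div_iff₀ hδ]; linarith
    have := Real.one_sub_inv_le_log_of_pos (show (0 : ℝ) < 1.25 by norm_num)
    norm_num at this ⊢
    norm_num at h1
    linarith
  have hc2 : c ^ 2 = 2 * Real.log (1.25 / δ) := by
    rw [hc, Real.sq_sqrt (by linarith)]
  have hcpos : 0 < c := by rw [hc]; exact Real.sqrt_pos.2 (by linarith)
  -- From `c² ≥ 2 / 5`, as `δ < 1` and `log 1.25 ≥ 1 / 5`.
  have hcl : 0.63 ≤ c := by nlinarith
  have hδe : δ = 1.25 * Real.exp (-c ^ 2 / 2) := by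
    rw [hc2, show -(2 * Real.log (1.25 / δ)) / 2 = -Real.log (1.25 / δ) by ring, Real.exp_neg,
      Real.exp_log (by positivity)]
    field_simp
  have hmul : c * (ε / (2 * c)) = ε / 2 := by field_simp
  rcases le_total 0 (c - ε / (2 * c)) with ht | ht
  · refine (gaussianReal_Ioi_le_of_nonneg ht).trans (ENNReal.ofReal_le_ofReal ?_)
    have h1 : -(c - ε / (2 * c)) ^ 2 / 2 ≤ -c ^ 2 / 2 + 1 / 2 := by
      nlinarith [sq_nonneg (ε / (2 * c))]
    have h2 : Real.exp (-(c - ε / (2 * c)) ^ 2 / 2) ≤ Real.exp (-c ^ 2 / 2) * Real.exp (1 / 2) := by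
      rw [← Real.exp_add]; exact Real.exp_le_exp.2 h1
    have h3 : Real.exp (1 / 2) ≤ 2 := by
      have h4 : Real.exp (1 / 2) ^ 2 = Real.exp 1 := by rw [← Real.exp_nat_mul]; norm_num
      have h5 := Real.exp_one_lt_d9
      nlinarith [Real.exp_pos (1 / 2)]
    have h6 := Real.exp_pos (-c ^ 2 / 2)
    nlinarith
  -- Here `c² ≤ ε / 2 ≤ 1 / 2`, so `δ = 1.25 exp (-c² / 2)` exceeds 0.93, while the tail bound stays
  -- below 0.67.
  · refine (gaussianReal_Ioi_le_of_nonpos ht).trans (ENNReal.ofReal_le_ofReal ?_)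
    have h0 : c ^ 2 ≤ ε / 2 := by nlinarith
    have h1 : ε / (2 * c) ≤ 1 / (2 * 0.63) := by gcongr
    have h2 : 1 - c ^ 2 / 2 ≤ Real.exp (-c ^ 2 / 2) := by
      have := Real.add_one_le_exp (-c ^ 2 / 2); linarith
    norm_num at h1
    nlinarith

end GaussianTail

/-! ### The Gaussian mechanism. -/

section GaussianMechanism

variable {E : Type*} [NormedAddCommGroup E] [InnerProductSpace ℝ E] [FiniteDimensional ℝ E]
  [MeasurableSpace E] [BorelSpace E]

/-- The loss depends on `x` only through `⟪v, x⟫`, so normalising `v` gives a one-dimensional tail.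
Its threshold `ε / ‖v‖ - ‖v‖ / 2` decreases in `‖v‖` and equals `c - ε / (2c)` at `‖v‖ = ε / c`. -/
theorem stdGaussian_privacyLoss_le {v : E} {ε δ c : ℝ} (hε : 0 < ε) (hε1 : ε ≤ 1) (hδ : 0 < δ)
    (hδ1 : δ < 1) (hc : c = Real.sqrt (2 * Real.log (1.25 / δ))) (hcpos : 0 < c)
    (hv : ‖v‖ ≤ ε / c) :
    stdGaussian E {x | ⟪v, x⟫ - ‖v‖ ^ 2 / 2 < -ε} ≤ ENNReal.ofReal δ := by
  rcases eq_or_ne v 0 with rfl | hv0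
  · simp [hε.not_gt]
  have hvp : 0 < ‖v‖ := norm_pos_iff.2 hv0
  set u : E := (-‖v‖⁻¹) • v
  have hu : ‖u‖ = 1 := by simp [u, norm_smul, hvp.ne']
  have hm := map_inner_stdGaussian u
  rw [hu, one_pow, Real.toNNReal_one] at hm
  refine le_trans ?_ (gaussianReal_Ioi_privacyLoss_le hε hε1 hδ hδ1 hc)
  rw [← hm, Measure.map_apply (by fun_prop) measurableSet_Ioi]
  refine measure_mono fun x hx => ?_
  simp only [Set.mem_ofPred_eq] at hx
  simp only [Set.mem_preimage, Set.mem_Ioi, u, real_inner_smul_left]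
  have h1 : c * ‖v‖ ≤ ε := by rw [le_div_iff₀ hcpos] at hv; linarith
  have h2 : c ≤ ε / ‖v‖ := by rwa [le_div_iff₀ hvp]
  have h3 : ‖v‖ / 2 ≤ ε / (2 * c) := by
    rw [le_div_iff₀ (by positivity)]; linarith
  have h4 : ε / ‖v‖ - ‖v‖ / 2 < -‖v‖⁻¹ * ⟪v, x⟫ := by
    have : ε / ‖v‖ - ‖v‖ / 2 = ‖v‖⁻¹ * (ε - ‖v‖ ^ 2 / 2) := by field_simp
    rw [this, neg_mul, ← mul_neg]
    exact mul_lt_mul_of_pos_left (by linarith) (inv_pos.2 hvp)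
  linarith

/-- Off the bad set `G` the Cameron–Martin density is at least `exp (-ε)`; `G` itself costs `δ`. -/
theorem stdGaussian_le_map_const_add {v : E} {ε δ c : ℝ} (hε : 0 < ε) (hε1 : ε ≤ 1) (hδ : 0 < δ)
    (hδ1 : δ < 1) (hc : c = Real.sqrt (2 * Real.log (1.25 / δ))) (hcpos : 0 < c)
    (hv : ‖v‖ ≤ ε / c) {S : Set E} (hS : MeasurableSet S) :
    stdGaussian E S ≤ ENNReal.ofReal (Real.exp ε) * (stdGaussian E).map (fun x => v + x) S +
      ENNReal.ofReal δ := by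
  set G : Set E := {x | ⟪v, x⟫ - ‖v‖ ^ 2 / 2 < -ε}
  have hG : MeasurableSet G := measurableSet_lt (by fun_prop) (by fun_prop)
  have h1 : stdGaussian E (S \ G) ≤
      ENNReal.ofReal (Real.exp ε) * (stdGaussian E).map (fun x => v + x) S := by
    rw [stdGaussian_map_const_add, withDensity_apply _ hS, ← lintegral_const_mul _ (by fun_prop)]
    calc stdGaussian E (S \ G) = ∫⁻ _ in S \ G, 1 ∂(stdGaussian E) := by simp
      _ ≤ ∫⁻ x in S \ G, ENNReal.ofReal (Real.exp ε) *
            ENNReal.ofReal (Real.exp (⟪v, x⟫ - ‖v‖ ^ 2 / 2)) ∂(stdGaussian E) := by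
          refine setLIntegral_mono' (hS.diff hG) fun x hx => ?_
          rw [← ENNReal.ofReal_mul (Real.exp_pos _).le, ← Real.exp_add, ENNReal.one_le_ofReal,
            Real.one_le_exp_iff]
          have : ¬ (⟪v, x⟫ - ‖v‖ ^ 2 / 2 < -ε) := hx.2
          linarith
      _ ≤ _ := lintegral_mono_set Set.sdiff_subset
  calc stdGaussian E S ≤ stdGaussian E (S \ G ∪ G) := measure_mono (by simp)
    _ ≤ stdGaussian E (S \ G) + stdGaussian E G := measure_union_le _ _
    _ ≤ _ := add_le_add h1 (stdGaussian_privacyLoss_le hε hε1 hδ hδ1 hc hcpos hv)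

/-- The Gaussian mechanism. -/
theorem gaussianRelease_le {ε δ α : ℝ} (hε : 0 < ε) (hε2 : ε ≤ 2) (hδ : 0 < δ) (hδ1 : δ < 1)
    (hα : 0 < α) {θ θ' : E} (hθ : ‖θ - θ'‖ ≤ α) {B : Set E} (hB : MeasurableSet B) :
    gaussianRelease ε δ α θ B ≤
      ENNReal.ofReal (Real.exp (ε / 2)) * gaussianRelease ε δ α θ' B + ENNReal.ofReal δ := by
  set c := Real.sqrt (2 * Real.log (1.25 / δ)) with hc
  have hcpos : 0 < c := by
    refine Real.sqrt_pos.2 (mul_pos two_pos (Real.log_pos ?_))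
    rw [lt_div_iff₀ hδ]; linarith
  set s := 2 * α / ε * c
  have hs : 0 < s := by positivity
  set v : E := s⁻¹ • (θ' - θ)
  have hv : ‖v‖ ≤ ε / 2 / c := by
    rw [norm_smul, norm_inv, Real.norm_of_nonneg hs.le, norm_sub_rev, inv_mul_le_iff₀ hs]
    refine hθ.trans_eq ?_
    simp only [s]; field_simp
  have hm : ∀ a : E, Measurable (fun ζ : E => a + s • ζ) := fun a => by fun_prop
  -- The noise scale `2αc / ε` is calibrated to the budget `ε / 2`, and `ε ≤ 2` says that this is at
  -- most 1.
  have key := stdGaussian_le_map_const_add (half_pos hε) (by linarith) hδ hδ1 hc hcpos hv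
    (hm θ hB)
  rw [gaussianRelease, gaussianRelease, Measure.map_apply (hm _) hB, Measure.map_apply (hm _) hB]
  rw [Measure.map_apply (by fun_prop) (hm θ hB)] at key
  convert key using 4
  ext x
  simp only [Set.mem_preimage, v, smul_add, smul_inv_smul₀ hs.ne', s]
  have : θ + (θ' - θ + s • x) = θ' + s • x := by abel
  rw [this]

end GaussianMechanism

/-! ### The logistic release probability. -/

section ReleaseProb

theorem ePTRReleaseProb_pos (ε δ g : ℝ) : 0 < ePTRReleaseProb ε δ g := by
  unfold ePTRReleaseProb; positivity

theorem one_sub_ePTRReleaseProb (ε δ g : ℝ) :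
    1 - ePTRReleaseProb ε δ g =
      1 / (Real.exp (ε * (g - ePTRThreshold ε δ) / 2) + 1) := by
  unfold ePTRReleaseProb
  have := Real.exp_pos (ε * (g - ePTRThreshold ε δ) / 2)
  field_simp
  ring

theorem one_sub_ePTRReleaseProb_pos (ε δ g : ℝ) : 0 < 1 - ePTRReleaseProb ε δ g := by
  rw [one_sub_ePTRReleaseProb]; positivity

theorem ePTRReleaseProb_le_exp (ε δ g : ℝ) :
    ePTRReleaseProb ε δ g ≤ Real.exp (ε * (g - ePTRThreshold ε δ) / 2) := by
  unfold ePTRReleaseProb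
  have := Real.exp_pos (ε * (g - ePTRThreshold ε δ) / 2)
  exact div_le_self this.le (by linarith)

theorem one_sub_ePTRReleaseProb_le_exp (ε δ g : ℝ) :
    1 - ePTRReleaseProb ε δ g ≤ Real.exp (-(ε * (g - ePTRThreshold ε δ) / 2)) := by
  rw [one_sub_ePTRReleaseProb, Real.exp_neg, ← one_div]
  have := Real.exp_pos (ε * (g - ePTRThreshold ε δ) / 2)
  gcongr
  linarith

/-- The logistic function has logarithmic derivative in `(0, 1)`, and its argument moves by at most
`ε / 2`. -/
theorem ePTRReleaseProb_le_mul {ε g g' : ℝ} (δ : ℝ) (hε : 0 < ε) (hg : |g - g'| ≤ 1) :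
    ePTRReleaseProb ε δ g ≤ Real.exp (ε / 2) * ePTRReleaseProb ε δ g' := by
  rw [abs_le] at hg
  unfold ePTRReleaseProb
  set a := ε * (g - ePTRThreshold ε δ) / 2
  set b := ε * (g' - ePTRThreshold ε δ) / 2
  have h : a ≤ ε / 2 + b := by simp only [a, b]; nlinarith
  have h2 : Real.exp a ≤ Real.exp (ε / 2) * Real.exp b := by
    rw [← Real.exp_add]; exact Real.exp_le_exp.2 h
  have h3 : 1 ≤ Real.exp (ε / 2) := Real.one_le_exp (by positivity)
  have ha := Real.exp_pos a
  have hb := Real.exp_pos b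
  rw [← mul_div_assoc, div_le_div_iff₀ (by positivity) (by positivity)]
  nlinarith [mul_pos ha hb]

theorem one_sub_ePTRReleaseProb_le_mul {ε g g' : ℝ} (δ : ℝ) (hε : 0 < ε) (hg : |g - g'| ≤ 1) :
    1 - ePTRReleaseProb ε δ g ≤ Real.exp (ε / 2) * (1 - ePTRReleaseProb ε δ g') := by
  rw [abs_le] at hg
  rw [one_sub_ePTRReleaseProb, one_sub_ePTRReleaseProb]
  set a := ε * (g - ePTRThreshold ε δ) / 2
  set b := ε * (g' - ePTRThreshold ε δ) / 2
  have h : b ≤ ε / 2 + a := by simp only [a, b]; nlinarith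
  have h2 : Real.exp b ≤ Real.exp (ε / 2) * Real.exp a := by
    rw [← Real.exp_add]; exact Real.exp_le_exp.2 h
  have h3 : 1 ≤ Real.exp (ε / 2) := Real.one_le_exp (by positivity)
  have ha := Real.exp_pos a
  have hb := Real.exp_pos b
  rw [← mul_div_assoc, div_le_div_iff₀ (by positivity) (by positivity)]
  nlinarith

/-- The threshold is chosen for this: at sub-distance zero the exponent is `-ε / 2 - log (max (1 /
δ) (1 / ε)) ≤ log δ`. -/
theorem ePTRReleaseProb_zero_le {ε δ : ℝ} (hε : 0 < ε) (hδ : 0 < δ) :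
    ePTRReleaseProb ε δ 0 ≤ δ := by
  refine (ePTRReleaseProb_le_exp ε δ 0).trans ?_
  have h1 : Real.log (1 / δ) ≤ Real.log (max (1 / δ) (1 / ε)) :=
    Real.log_le_log (by positivity) (le_max_left _ _)
  have h2 : ε * (0 - ePTRThreshold ε δ) / 2 = -(ε / 2) - Real.log (max (1 / δ) (1 / ε)) := by
    unfold ePTRThreshold; field_simp; ring
  rw [h2]
  calc Real.exp (-(ε / 2) - Real.log (max (1 / δ) (1 / ε))) ≤ Real.exp (Real.log δ) := by
        refine Real.exp_le_exp.2 ?_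
        have h3 : Real.log (1 / δ) = -Real.log δ := by rw [one_div, Real.log_inv]
        linarith
    _ = δ := Real.exp_log hδ

end ReleaseProb

/-! ### Privacy of propose-test-release. -/

section EPTR

variable {E : Type*} [NormedAddCommGroup E] [InnerProductSpace ℝ E] [FiniteDimensional ℝ E]
  [MeasurableSpace E] [BorelSpace E]

instance isProbabilityMeasure_gaussianRelease (ε δ α : ℝ) (θ : E) :
    IsProbabilityMeasure (gaussianRelease ε δ α θ) :=
  Measure.isProbabilityMeasure_map (Measurable.aemeasurable (by fun_prop))

theorem isProbabilityMeasure_ePTRLaw (ε δ α g : ℝ) (bot : Measure E) [IsProbabilityMeasure bot]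
    (θ : E) : IsProbabilityMeasure (ePTRLaw ε δ α bot θ g) := by
  constructor
  simp only [ePTRLaw, Measure.add_apply, Measure.smul_apply, measure_univ, smul_eq_mul, mul_one]
  rw [← ENNReal.ofReal_add (ePTRReleaseProb_pos ε δ g).le (one_sub_ePTRReleaseProb_pos ε δ g).le]
  simp

theorem ePTRLaw_le {ε δ α g g' : ℝ} (hε : 0 < ε) (hε2 : ε ≤ 2) (hδ : 0 < δ) (hα : 0 < α)
    (hg : 0 ≤ g) (hgg' : |g - g'| ≤ 1) {θ θ' : E} (hθ : 0 < g → ‖θ - θ'‖ ≤ α)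
    (bot : Measure E) [IsProbabilityMeasure bot] {B : Set E} (hB : MeasurableSet B) :
    ePTRLaw ε δ α bot θ g B ≤
      ENNReal.ofReal (Real.exp ε) * ePTRLaw ε δ α bot θ' g' B + ENNReal.ofReal δ := by
  -- For `δ ≥ 1` the additive term alone suffices. The Gaussian mechanism needs `δ < 1`.
  rcases le_or_gt 1 δ with hδ1 | hδ1
  · have := isProbabilityMeasure_ePTRLaw ε δ α g bot θ
    refine prob_le_one.trans (le_add_left ?_)
    exact ENNReal.one_le_ofReal.2 hδ1
  set q := ePTRReleaseProb ε δ g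
  set q' := ePTRReleaseProb ε δ g'
  have hq : 0 < q := ePTRReleaseProb_pos ε δ g
  have hq1 : 0 < 1 - q := one_sub_ePTRReleaseProb_pos ε δ g
  have hee : Real.exp (ε / 2) * Real.exp (ε / 2) = Real.exp ε := by
    rw [← Real.exp_add]; ring_nf
  have h1e : 1 ≤ Real.exp (ε / 2) := Real.one_le_exp (by positivity)
  have hee' : Real.exp (ε / 2) ≤ Real.exp ε := Real.exp_le_exp.2 (by linarith)
  have hbot : ENNReal.ofReal (1 - q) * bot B ≤
      ENNReal.ofReal (Real.exp ε) * (ENNReal.ofReal (1 - q') * bot B) := by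
    rw [← mul_assoc, ← ENNReal.ofReal_mul (Real.exp_pos _).le]
    gcongr
    refine (one_sub_ePTRReleaseProb_le_mul δ hε hgg').trans ?_
    have := (one_sub_ePTRReleaseProb_pos ε δ g').le
    gcongr
  have hrel : ENNReal.ofReal q * gaussianRelease ε δ α θ B ≤
      ENNReal.ofReal (Real.exp ε) * (ENNReal.ofReal q' * gaussianRelease ε δ α θ' B) +
        ENNReal.ofReal δ := by
    rcases hg.eq_or_lt with h0 | hpos
    -- At sub-distance zero no sensitivity bound is available, and the whole release branch goes
    -- into `δ`.
    · refine le_add_left ?_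
      calc ENNReal.ofReal q * gaussianRelease ε δ α θ B ≤ ENNReal.ofReal q * 1 := by
            gcongr; exact prob_le_one
        _ ≤ ENNReal.ofReal δ := by
            rw [mul_one]
            refine ENNReal.ofReal_le_ofReal ?_
            simp only [q, ← h0]
            exact ePTRReleaseProb_zero_le hε hδ
    · calc ENNReal.ofReal q * gaussianRelease ε δ α θ B
          ≤ ENNReal.ofReal q * (ENNReal.ofReal (Real.exp (ε / 2)) * gaussianRelease ε δ α θ' B +
              ENNReal.ofReal δ) := by
            gcongr
            exact gaussianRelease_le hε hε2 hδ hδ1 hα (hθ hpos) hB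
        _ = ENNReal.ofReal (q * Real.exp (ε / 2)) * gaussianRelease ε δ α θ' B +
              ENNReal.ofReal (q * δ) := by
            rw [mul_add, ← mul_assoc, ← ENNReal.ofReal_mul hq.le, ← ENNReal.ofReal_mul hq.le]
        _ ≤ ENNReal.ofReal (Real.exp ε * q') * gaussianRelease ε δ α θ' B +
              ENNReal.ofReal δ := by
            refine add_le_add (mul_le_mul_left (ENNReal.ofReal_le_ofReal ?_) _)
              (ENNReal.ofReal_le_ofReal ?_)
            · have := ePTRReleaseProb_le_mul δ hε hgg'
              calc q * Real.exp (ε / 2) ≤ (Real.exp (ε / 2) * q') * Real.exp (ε / 2) := by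
                    gcongr
                _ = Real.exp ε * q' := by rw [← hee]; ring
            · nlinarith
        _ = _ := by rw [ENNReal.ofReal_mul (Real.exp_pos _).le, mul_assoc]
  simp only [ePTRLaw, Measure.add_apply, Measure.smul_apply, smul_eq_mul]
  calc _ ≤ (ENNReal.ofReal (Real.exp ε) * (ENNReal.ofReal q' * gaussianRelease ε δ α θ' B) +
        ENNReal.ofReal δ) + ENNReal.ofReal (Real.exp ε) * (ENNReal.ofReal (1 - q') * bot B) :=
        add_le_add hrel hbot
    _ = _ := by ring

end EPTR

/-! ### Sensitivity of the Bayes classifier and its privacy. -/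

section BallProj

variable {E : Type*} [NormedAddCommGroup E] [NormedSpace ℝ E]

theorem norm_ballProj_le {R : ℝ} (hR : 0 ≤ R) (x : E) : ‖ballProj R x‖ ≤ R := by
  have hm : 0 ≤ max ‖x‖ R := (norm_nonneg x).trans (le_max_left _ _)
  rw [ballProj, norm_smul, Real.norm_of_nonneg (div_nonneg hR hm), div_mul_eq_mul_div]
  exact div_le_of_le_mul₀ hm hR (mul_le_mul_of_nonneg_left (le_max_left _ _) hR)

end BallProj

section Sensitivity

variable {K p n : ℕ}

theorem norm_sub_bayesParam_sq (μ : Fin K → ℝ) (m : Fin K → EuclideanSpace ℝ (Fin p))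
    (t : BayesParam K p) : ‖t - bayesParam μ m‖ ^ 2 = bayesSqError μ m t := by
  rw [WithLp.prod_norm_sq_eq_of_L2, EuclideanSpace.norm_sq_eq, PiLp.norm_sq_eq_of_L2,
    bayesSqError, Finset.sum_add_distrib]
  rfl

/-- A dataset with one entry removed, summed over the class `k`. -/
theorem sum_classIndices_eq {M : Type*} [AddCommMonoid M] (X : Fin n → LabelledPoint K p)
    (k : Fin K) (f : LabelledPoint K p → M) (i : Fin n) :
    ∑ j ∈ classIndices X k, f (X j) =
      (if (X i).2 = k then f (X i) else 0) +
        ∑ j ∈ Finset.univ.erase i, if (X j).2 = k then f (X j) else 0 := by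
  rw [classIndices, Finset.sum_filter]
  exact (Finset.add_sum_erase _ (fun j => if (X j).2 = k then f (X j) else 0)
    (Finset.mem_univ i)).symm

theorem card_classIndices_eq (X : Fin n → LabelledPoint K p) (k : Fin K) (i : Fin n) :
    ((classIndices X k).card : ℝ) =
      (if (X i).2 = k then 1 else 0) +
        ∑ j ∈ Finset.univ.erase i, if (X j).2 = k then (1 : ℝ) else 0 := by
  rw [← sum_classIndices_eq X k (fun _ => (1 : ℝ)) i]
  simp

theorem abs_card_classIndices_sub_le {X X' : Fin n → LabelledPoint K p} {i : Fin n}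
    (h : ∀ j, j ≠ i → X j = X' j) (k : Fin K) :
    |((classIndices X k).card : ℝ) - (classIndices X' k).card| ≤ 1 := by
  have hs : ∑ j ∈ Finset.univ.erase i, (if (X j).2 = k then (1 : ℝ) else 0) =
      ∑ j ∈ Finset.univ.erase i, if (X' j).2 = k then (1 : ℝ) else 0 :=
    Finset.sum_congr rfl fun j hj => by rw [h j (Finset.ne_of_mem_erase hj)]
  rw [card_classIndices_eq X k i, card_classIndices_eq X' k i, hs]
  split_ifs <;> simp

theorem ciInf_le_ciInf_add_of_finite {ι : Type*} [Finite ι] [Nonempty ι] {f g : ι → ℝ} {c : ℝ}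
    (h : ∀ i, f i ≤ g i + c) : ⨅ i, f i ≤ (⨅ i, g i) + c := by
  rw [← sub_le_iff_le_add]
  exact le_ciInf fun i =>
    sub_le_iff_le_add.2 ((ciInf_le (Set.finite_range f).bddBelow i).trans (h i))

theorem abs_bayesSubDist_sub_le (c₀ : ℝ) {X X' : Fin n → LabelledPoint K p} {i : Fin n}
    (h : ∀ j, j ≠ i → X j = X' j) : |bayesSubDist c₀ X - bayesSubDist c₀ X'| ≤ 1 := by
  have : Nonempty (Fin K) := ⟨(X i).2⟩
  refine (abs_max_sub_max_le_abs _ _ _).trans ?_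
  have hc := fun k => abs_le.1 (abs_card_classIndices_sub_le h k)
  have h1 := ciInf_le_ciInf_add_of_finite (f := fun k => ((classIndices X k).card : ℝ))
    (g := fun k => ((classIndices X' k).card : ℝ)) (c := 1) fun k => by linarith [(hc k).2]
  have h2 := ciInf_le_ciInf_add_of_finite (f := fun k => ((classIndices X' k).card : ℝ))
    (g := fun k => ((classIndices X k).card : ℝ)) (c := 1) fun k => by linarith [(hc k).1]
  rw [abs_le]
  constructor <;> linarith

theorem card_gt_of_bayesSubDist_pos {c₀ : ℝ} {X : Fin n → LabelledPoint K p}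
    (h : 0 < bayesSubDist c₀ X) (k : Fin K) : c₀ * n + 1 < (classIndices X k).card := by
  have h1 : 0 < (⨅ k : Fin K, ((classIndices X k).card : ℝ)) - c₀ * n - 1 := by
    by_contra hc
    rw [bayesSubDist, max_eq_right (not_lt.1 hc)] at h
    exact lt_irrefl _ h
  have h2 : (⨅ k : Fin K, ((classIndices X k).card : ℝ)) ≤ (classIndices X k).card :=
    ciInf_le (Set.finite_range _).bddBelow k
  linarith

/-- The change is `(1 + c)⁻¹` times the difference of the new point and the old mean, both of norm
at most `R`. -/
theorem norm_mean_insert_sub_le {E : Type*} [NormedAddCommGroup E] [NormedSpace ℝ E] {T a : E}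
    {c L R : ℝ} (hL : 0 < L) (hc : L ≤ c) (hR : 0 ≤ R) (ha : ‖a‖ ≤ R) (hT : ‖T‖ ≤ c * R) :
    ‖(1 + c)⁻¹ • (a + T) - c⁻¹ • T‖ ≤ 2 * R / L := by
  have hc0 : 0 < c := hL.trans_le hc
  have h : (1 + c)⁻¹ • (a + T) - c⁻¹ • T = (1 + c)⁻¹ • (a - c⁻¹ • T) := by
    have h1 : (1 + c) • ((1 + c)⁻¹ • (a + T) - c⁻¹ • T) = a - c⁻¹ • T := by
      rw [smul_sub, smul_inv_smul₀ (by positivity), add_smul, one_smul, smul_inv_smul₀ hc0.ne']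
      abel
    rw [← h1, inv_smul_smul₀ (by positivity)]
  rw [h, norm_smul, norm_inv, Real.norm_of_nonneg (by positivity), inv_mul_eq_div]
  have h2 : ‖c⁻¹ • T‖ ≤ R := by
    rw [norm_smul, norm_inv, Real.norm_of_nonneg hc0.le, inv_mul_le_iff₀ hc0]
    exact hT
  have h3 : ‖a - c⁻¹ • T‖ ≤ 2 * R := (norm_sub_le _ _).trans (by linarith)
  gcongr
  linarith

/-- Both means are compared through the common remainder without entry `i`, with count `c` and sum
`T`. The indicators record that only the old and the new label of that entry are affected, so they
sum to 2 over all classes. -/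
theorem norm_sampleMean_sub_le {R c₀ : ℝ} (hR : 0 ≤ R) (hc₀ : 0 < c₀) {X X' : Fin n → LabelledPoint K p}
    {i : Fin n} (h : ∀ j, j ≠ i → X j = X' j) (hX : 0 < bayesSubDist c₀ X) (k : Fin K) :
    ‖sampleMean R X k - sampleMean R X' k‖ ^ 2 ≤
      (2 * R / (c₀ * n)) ^ 2 * ((if (X i).2 = k then 1 else 0) + if (X' i).2 = k then 1 else 0) := by
  have hn : (0 : ℝ) < n := by exact_mod_cast i.pos
  have hL : 0 < c₀ * n := by positivity
  set c : ℝ := ∑ j ∈ Finset.univ.erase i, if (X j).2 = k then (1 : ℝ) else 0 with hc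
  set T : EuclideanSpace ℝ (Fin p) :=
    ∑ j ∈ Finset.univ.erase i, if (X j).2 = k then ballProj R (X j).1 else 0 with hT
  have hc' : c = ∑ j ∈ Finset.univ.erase i, if (X' j).2 = k then (1 : ℝ) else 0 :=
    Finset.sum_congr rfl fun j hj => by rw [h j (Finset.ne_of_mem_erase hj)]
  have hT' : T = ∑ j ∈ Finset.univ.erase i, if (X' j).2 = k then ballProj R (X' j).1 else 0 :=
    Finset.sum_congr rfl fun j hj => by rw [h j (Finset.ne_of_mem_erase hj)]
  have hcard := card_gt_of_bayesSubDist_pos hX k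
  rw [card_classIndices_eq X k i, ← hc] at hcard
  -- The `-1` in `bayesSubDist` pays for the removed entry. The remainder is shared with `X'`, so
  -- positivity at `X` is enough.
  have hLc : c₀ * n ≤ c := by split_ifs at hcard <;> linarith
  have hTc : ‖T‖ ≤ c * R := by
    rw [hT, hc, Finset.sum_mul]
    refine norm_sum_le_of_le _ fun j _ => ?_
    split_ifs
    · simpa using norm_ballProj_le hR (X j).1
    · simp
  have ha := norm_ballProj_le hR (X i).1
  have ha' := norm_ballProj_le hR (X' i).1
  have hm := norm_mean_insert_sub_le hL hLc hR ha hTc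
  have hm' := norm_mean_insert_sub_le hL hLc hR ha' hTc
  rw [norm_sub_rev] at hm'
  rw [sampleMean, sampleMean, card_classIndices_eq X k i, card_classIndices_eq X' k i,
    sum_classIndices_eq X k (fun z => ballProj R z.1) i,
    sum_classIndices_eq X' k (fun z => ballProj R z.1) i, ← hc, ← hc', ← hT, ← hT']
  split_ifs
  · rw [← smul_sub, add_sub_add_right_eq_sub, norm_smul, norm_inv,
      Real.norm_of_nonneg (by linarith), inv_mul_eq_div]
    have h3 : ‖ballProj R (X i).1 - ballProj R (X' i).1‖ ≤ 2 * R :=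
      (norm_sub_le _ _).trans (by linarith)
    have h4 : ‖ballProj R (X i).1 - ballProj R (X' i).1‖ / (1 + c) ≤ 2 * R / (c₀ * n) := by
      gcongr; linarith
    have h5 := pow_le_pow_left₀ (div_nonneg (norm_nonneg _) (by linarith)) h4 2
    nlinarith [sq_nonneg (2 * R / (c₀ * n))]
  · simpa using pow_le_pow_left₀ (norm_nonneg _) hm 2
  · simpa using pow_le_pow_left₀ (norm_nonneg _) hm' 2
  · simp

theorem abs_sampleFreq_sub_le {X X' : Fin n → LabelledPoint K p}
    {i : Fin n} (h : ∀ j, j ≠ i → X j = X' j) (k : Fin K) :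
    |sampleFreq X k - sampleFreq X' k| ^ 2 ≤
      (1 / n) ^ 2 * ((if (X i).2 = k then 1 else 0) + if (X' i).2 = k then 1 else 0) := by
  have hc' : ∑ j ∈ Finset.univ.erase i, (if (X j).2 = k then (1 : ℝ) else 0) =
      ∑ j ∈ Finset.univ.erase i, if (X' j).2 = k then (1 : ℝ) else 0 :=
    Finset.sum_congr rfl fun j hj => by rw [h j (Finset.ne_of_mem_erase hj)]
  rw [sampleFreq, sampleFreq, ← sub_div, div_eq_inv_mul, sq_abs, mul_pow, one_div,
    card_classIndices_eq X k i, card_classIndices_eq X' k i, hc']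
  gcongr
  split_ifs <;> norm_num

theorem norm_bayesParam_sub_le {R c₀ : ℝ} (hR : 0 ≤ R) (hc₀ : 0 < c₀)
    {X X' : Fin n → LabelledPoint K p} {i : Fin n} (h : ∀ j, j ≠ i → X j = X' j)
    (hX : 0 < bayesSubDist c₀ X) :
    ‖bayesParam (sampleFreq X) (sampleMean R X) - bayesParam (sampleFreq X') (sampleMean R X')‖ ≤
      bayesSensitivity n R c₀ := by
  have hn : (0 : ℝ) < n := by exact_mod_cast i.pos
  have hα : 0 ≤ bayesSensitivity n R c₀ := by unfold bayesSensitivity; positivity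
  refine le_of_sq_le_sq ?_ hα
  rw [norm_sub_bayesParam_sq, bayesSqError]
  calc ∑ k, (|sampleFreq X k - sampleFreq X' k| ^ 2 + ‖sampleMean R X k - sampleMean R X' k‖ ^ 2)
      ≤ ∑ k, ((1 / n) ^ 2 + (2 * R / (c₀ * n)) ^ 2) *
          ((if (X i).2 = k then 1 else 0) + if (X' i).2 = k then 1 else 0) := by
        refine Finset.sum_le_sum fun k _ => ?_
        rw [add_mul]
        exact add_le_add (abs_sampleFreq_sub_le h k) (norm_sampleMean_sub_le hR hc₀ h hX k)
    _ = ((1 / n) ^ 2 + (2 * R / (c₀ * n)) ^ 2) * 2 := by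
        rw [← Finset.mul_sum, Finset.sum_add_distrib]
        simp only [Finset.sum_ite_eq, Finset.mem_univ, if_true]
        norm_num
    _ ≤ bayesSensitivity n R c₀ ^ 2 := by
        rw [bayesSensitivity, mul_pow, Real.sq_sqrt (by positivity), div_pow, div_pow, div_pow,
          ← sub_nonneg]
        have : (2 : ℝ) ^ 2 / n ^ 2 * (2 * R ^ 2 / c₀ ^ 2 + 2) -
            (1 ^ 2 / n ^ 2 + (2 * R) ^ 2 / (c₀ * n) ^ 2) * 2 = 6 / (n : ℝ) ^ 2 := by
          field_simp; ring
        rw [this]; positivity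

theorem measurable_bayesAugment (c₀ : ℝ) : Measurable (bayesAugment (K := K) (p := p) c₀) := by
  unfold bayesAugment bayesParam
  fun_prop

theorem isDP_bayesEPTR {ε δ R c₀ : ℝ} (bot : Measure (BayesParam K p)) [IsProbabilityMeasure bot]
    (hε : 0 < ε) (hε2 : ε ≤ 2) (hδ : 0 < δ) (hR : 0 ≤ R) (hc₀ : 0 < c₀) :
    IsDP ε δ (bayesEPTR (n := n) ε δ R c₀ bot) := by
  rintro X X' ⟨i, -, hi⟩ B hB
  have h : ∀ j, j ≠ i → X j = X' j := fun j hj => by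
    by_contra hne
    exact hj (hi j hne)
  have hn : (0 : ℝ) < n := by exact_mod_cast i.pos
  have hα : 0 < bayesSensitivity n R c₀ := by unfold bayesSensitivity; positivity
  rw [bayesEPTR, bayesEPTR, Measure.map_apply (measurable_bayesAugment c₀) hB,
    Measure.map_apply (measurable_bayesAugment c₀) hB]
  exact ePTRLaw_le hε hε2 hδ hα (le_max_right _ _) (abs_bayesSubDist_sub_le c₀ h)
    (norm_bayesParam_sub_le hR hc₀ h) bot (measurable_bayesAugment c₀ hB)

end Sensitivity

/-! ### Second moments of i.i.d. sums. -/

section SumPi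

/-- Second moment is variance plus squared mean, and variances add. The mean is kept apart because
projected features are biased. -/
theorem integral_sq_sum_pi_le {Z : Type*} [MeasurableSpace Z] (P : Measure Z)
    [IsProbabilityMeasure P] {f : Z → ℝ} (hf : MemLp f 2 P) (n : ℕ) :
    Integrable (fun X : Fin n → Z => (∑ j, f (X j)) ^ 2) (Measure.pi fun _ => P) ∧
      ∫ X : Fin n → Z, (∑ j, f (X j)) ^ 2 ∂(Measure.pi fun _ => P) ≤
        n * ∫ z, f z ^ 2 ∂P + n ^ 2 * (∫ z, f z ∂P) ^ 2 := by
  have hj : ∀ j : Fin n, MemLp (fun X : Fin n → Z => f (X j)) 2 (Measure.pi fun _ => P) :=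
    fun j => hf.comp_measurePreserving (measurePreserving_eval _ j)
  have hS : MemLp (fun X : Fin n → Z => ∑ j, f (X j)) 2 (Measure.pi fun _ => P) :=
    memLp_finsetSum _ fun j _ => hj j
  refine ⟨hS.integrable_sq, ?_⟩
  have hv := variance_sum_pi (μ := fun _ : Fin n => P) (X := fun _ => f) fun _ => hf
  have he : (∑ i, fun ω : Fin n → Z => f (ω i)) = fun X : Fin n → Z => ∑ j, f (X j) := by
    ext; simp
  rw [he, variance_eq_sub hS] at hv
  have hm : ∫ X : Fin n → Z, ∑ j, f (X j) ∂(Measure.pi fun _ => P) = n * ∫ z, f z ∂P := by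
    rw [integral_finsetSum _ fun j _ => (hj j).integrable (by norm_num)]
    simp_rw [integral_comp_eval (μ := fun _ : Fin n => P) hf.aestronglyMeasurable]
    simp
  have hvar : Var[f; P] ≤ ∫ z, f z ^ 2 ∂P := by
    rw [variance_eq_sub hf]
    simp only [Pi.pow_apply]
    linarith [sq_nonneg (∫ z, f z ∂P)]
  simp only [Pi.pow_apply, hm, Finset.sum_const, Finset.card_univ, Fintype.card_fin,
    nsmul_eq_mul] at hv
  have := mul_le_mul_of_nonneg_left hvar (Nat.cast_nonneg (α := ℝ) n)
  linarith [mul_pow (n : ℝ) (∫ z, f z ∂P) 2]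

end SumPi

/-! ### Gaussian moments. -/

section GaussianMoments

theorem integral_exp_sq_gaussianReal :
    Integrable (fun x : ℝ => Real.exp (x ^ 2 / 4)) (gaussianReal 0 1) ∧
      ∫ x, Real.exp (x ^ 2 / 4) ∂(gaussianReal 0 1) ≤ 2 := by
  have he : ∀ x : ℝ, gaussianPDFReal 0 1 x * Real.exp (x ^ 2 / 4) =
      (Real.sqrt (2 * Real.pi))⁻¹ * Real.exp (-(1 / 4) * x ^ 2) := by
    intro x
    rw [gaussianPDFReal, mul_assoc, ← Real.exp_add]
    simp only [NNReal.coe_one, sub_zero, mul_one]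
    congr 2
    ring
  constructor
  · rw [gaussianReal_of_var_ne_zero _ one_ne_zero,
      integrable_withDensity_iff (by fun_prop) (by simp [gaussianPDF])]
    refine ((integrable_exp_neg_mul_sq (b := 1 / 4) (by norm_num)).const_mul
      (Real.sqrt (2 * Real.pi))⁻¹).congr (Filter.Eventually.of_forall fun x => ?_)
    simp only [toReal_gaussianPDF]
    rw [mul_comm (Real.exp _), he]
  · rw [integral_gaussianReal_eq_integral_smul one_ne_zero]
    simp_rw [smul_eq_mul, he]
    rw [integral_const_mul, integral_gaussian, inv_mul_le_iff₀ (by positivity)]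
    refine Real.sqrt_le_iff.2 ⟨by positivity, ?_⟩
    rw [mul_pow, Real.sq_sqrt (by positivity)]
    nlinarith [Real.pi_pos]

theorem integral_sq_gaussianReal :
    Integrable (fun x : ℝ => x ^ 2) (gaussianReal 0 1) ∧
      ∫ x, x ^ 2 ∂(gaussianReal 0 1) = 1 := by
  have h := memLp_id_gaussianReal (μ := 0) (v := 1) 2
  refine ⟨h.integrable_sq, ?_⟩
  have hv := variance_id_gaussianReal (μ := 0) (v := 1)
  rw [variance_eq_sub h] at hv
  simpa [integral_id_gaussianReal] using hv

theorem integral_norm_sq_stdGaussian {E : Type*} [NormedAddCommGroup E] [InnerProductSpace ℝ E]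
    [FiniteDimensional ℝ E] [MeasurableSpace E] [BorelSpace E] :
    Integrable (fun x : E => ‖x‖ ^ 2) (stdGaussian E) ∧
      ∫ x, ‖x‖ ^ 2 ∂(stdGaussian E) = Module.finrank ℝ E := by
  set b := stdOrthonormalBasis ℝ E
  have hm : ∀ i, (stdGaussian E).map (fun x => ⟪b i, x⟫) = gaussianReal 0 1 := fun i => by
    rw [map_inner_stdGaussian]; simp
  have hi : ∀ i, Integrable (fun x : E => ⟪b i, x⟫ ^ 2) (stdGaussian E) ∧
      ∫ x, ⟪b i, x⟫ ^ 2 ∂(stdGaussian E) = 1 := by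
    intro i
    have h := integral_sq_gaussianReal
    rw [← hm i] at h
    refine ⟨h.1.comp_measurable (by fun_prop), ?_⟩
    rw [← h.2, integral_map (by fun_prop) (by fun_prop)]
  have hs : (fun x : E => ‖x‖ ^ 2) = fun x => ∑ i, ⟪b i, x⟫ ^ 2 := by
    ext x; exact (b.sum_sq_inner_right x).symm
  rw [hs]
  refine ⟨integrable_finsetSum _ fun i _ => (hi i).1, ?_⟩
  rw [integral_finsetSum _ fun i _ => (hi i).1]
  simp [(hi _).2]

variable {p : ℕ}

theorem map_eval_sub_multivariateGaussian (m : EuclideanSpace ℝ (Fin p)) (i : Fin p) :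
    (multivariateGaussian m 1).map (fun x => x i - m i) = gaussianReal 0 1 := by
  have h := (measurePreserving_eval_multivariateGaussian (μ := m)
    (S := (1 : Matrix (Fin p) (Fin p) ℝ)) Matrix.PosSemidef.one (i := i)).map_eq
  have h2 := gaussianReal_map_sub_const (μ := m i) (v := 1) (m i)
  rw [Matrix.one_apply_eq, Real.toNNReal_one] at h
  rw [← h, Measure.map_map (by fun_prop) (by fun_prop), sub_self] at h2
  exact h2

theorem integral_eval_sub_multivariateGaussian (m : EuclideanSpace ℝ (Fin p)) (i : Fin p)
    {f : ℝ → ℝ} (hf : Measurable f) (hfi : Integrable f (gaussianReal 0 1)) :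
    Integrable (fun x => f (x i - m i)) (multivariateGaussian m 1) ∧
      ∫ x, f (x i - m i) ∂(multivariateGaussian m 1) = ∫ x, f x ∂(gaussianReal 0 1) := by
  rw [← map_eval_sub_multivariateGaussian m i] at hfi ⊢
  refine ⟨hfi.comp_measurable (by fun_prop), ?_⟩
  rw [integral_map (by fun_prop) (by fun_prop)]

theorem integral_norm_sub_sq_multivariateGaussian (m : EuclideanSpace ℝ (Fin p)) :
    Integrable (fun x => ‖x - m‖ ^ 2) (multivariateGaussian m 1) ∧
      ∫ x, ‖x - m‖ ^ 2 ∂(multivariateGaussian m 1) = p := by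
  have hi := fun i => integral_eval_sub_multivariateGaussian m i (f := fun x => x ^ 2)
    (by fun_prop) integral_sq_gaussianReal.1
  simp_rw [EuclideanSpace.norm_sq_eq, Real.norm_eq_abs, sq_abs, PiLp.sub_apply]
  refine ⟨integrable_finsetSum _ fun i _ => (hi i).1, ?_⟩
  rw [integral_finsetSum _ fun i _ => (hi i).1]
  simp [(hi _).2, integral_sq_gaussianReal.2]

theorem integral_sum_exp_multivariateGaussian (m : EuclideanSpace ℝ (Fin p)) :
    Integrable (fun x => ∑ i, Real.exp ((x i - m i) ^ 2 / 4)) (multivariateGaussian m 1) ∧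
      ∫ x, ∑ i, Real.exp ((x i - m i) ^ 2 / 4) ∂(multivariateGaussian m 1) ≤ p * 2 := by
  have hi := fun i => integral_eval_sub_multivariateGaussian m i
    (f := fun x => Real.exp (x ^ 2 / 4)) (by fun_prop) integral_exp_sq_gaussianReal.1
  refine ⟨integrable_finsetSum _ fun i _ => (hi i).1, ?_⟩
  rw [integral_finsetSum _ fun i _ => (hi i).1]
  simp only [(hi _).2, Finset.sum_const, Finset.card_univ, Fintype.card_fin, nsmul_eq_mul]
  gcongr
  exact integral_exp_sq_gaussianReal.2

/-- Jensen's inequality for `exp` over the coordinates. It controls `‖z‖² / p` by one-dimensional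
exponential moments, with no constant depending on `p`. -/
theorem exp_norm_sq_div_le (hp : 1 ≤ p) (z : EuclideanSpace ℝ (Fin p)) :
    p * Real.exp (‖z‖ ^ 2 / p / 4) ≤ ∑ i, Real.exp (z i ^ 2 / 4) := by
  have hp0 : (0 : ℝ) < p := by exact_mod_cast hp
  have h := convexOn_exp.map_sum_le (t := Finset.univ) (w := fun _ : Fin p => (p : ℝ)⁻¹)
    (p := fun i => z i ^ 2 / 4) (fun _ _ => by positivity)
    (by simp [hp0.ne']) (fun _ _ => Set.mem_univ _)
  simp only [smul_eq_mul, ← Finset.mul_sum] at h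
  rw [EuclideanSpace.norm_sq_eq]
  simp only [Real.norm_eq_abs, sq_abs]
  rw [show (∑ i, z i ^ 2) / (p : ℝ) / 4 = (p : ℝ)⁻¹ * ∑ i, z i ^ 2 / 4 by
    rw [← Finset.sum_div]; field_simp]
  rw [← le_inv_mul_iff₀ hp0]
  exact h

end GaussianMoments

/-! ### The error of the projection onto the ball. -/

section ProjectionBias

variable {E : Type*} [NormedAddCommGroup E] [NormedSpace ℝ E]

theorem ballProj_of_norm_le {R : ℝ} {x : E} (h : ‖x‖ ≤ R) : ballProj R x = x := by
  rcases (norm_nonneg x).trans h |>.eq_or_lt with h0 | hpos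
  · have : x = 0 := norm_le_zero_iff.1 (h0 ▸ h)
    simp [ballProj, this]
  · rw [ballProj, max_eq_right h, div_self hpos.ne', one_smul]

theorem norm_ballProj_le_norm {R : ℝ} (hR : 0 ≤ R) (x : E) : ‖ballProj R x‖ ≤ ‖x‖ := by
  have hm : 0 ≤ max ‖x‖ R := (norm_nonneg x).trans (le_max_left _ _)
  rw [ballProj, norm_smul, Real.norm_of_nonneg (div_nonneg hR hm)]
  exact mul_le_of_le_one_left (norm_nonneg _) (div_le_one_of_le₀ (le_max_right _ _) hm)

theorem norm_ballProj_sub_le {R : ℝ} (hR : 0 ≤ R) (x : E) : ‖ballProj R x - x‖ ≤ ‖x‖ := by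
  have hm : 0 ≤ max ‖x‖ R := (norm_nonneg x).trans (le_max_left _ _)
  have h0 : 0 ≤ R / max ‖x‖ R := div_nonneg hR hm
  have h1 : R / max ‖x‖ R ≤ 1 := div_le_one_of_le₀ (le_max_right _ _) hm
  have h : ballProj R x - x = (R / max ‖x‖ R - 1) • x := by rw [sub_smul, one_smul]; rfl
  rw [h, norm_smul, Real.norm_eq_abs, abs_of_nonpos (by linarith)]
  exact mul_le_of_le_one_left (norm_nonneg _) (by linarith)

theorem measurable_ballProj [MeasurableSpace E] [BorelSpace E] [SecondCountableTopology E]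
    (R : ℝ) : Measurable (ballProj R : E → E) := by
  unfold ballProj; fun_prop

theorem two_le_log_of_eight_le {n : ℕ} (hn : 8 ≤ n) : 2 ≤ Real.log n := by
  have h1 : Real.log 8 ≤ Real.log n :=
    Real.log_le_log (by norm_num) (by exact_mod_cast hn)
  have h2 : Real.log 8 = 3 * Real.log 2 := by
    rw [show (8 : ℝ) = 2 ^ 3 by norm_num, Real.log_pow]; norm_num
  have := Real.log_two_gt_d9
  linarith

variable {p n : ℕ} {Cm : ℝ}

/-- Only `‖x‖ > R` contributes. There `u = ‖x - m‖² / p` is at least `8 log n`, so half of `exp (u /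
4)` supplies the factor `1 / n` and the other half dominates `u`. -/
theorem norm_ballProj_sub_sq_le (hp : 1 ≤ p) (hn : 8 ≤ n) (hCm : 1 ≤ Cm)
    {m : EuclideanSpace ℝ (Fin p)} (hm : ‖m‖ ≤ Cm * Real.sqrt p) (x : EuclideanSpace ℝ (Fin p)) :
    ‖ballProj (4 * Cm * Real.sqrt (p * |Real.log n|)) x - x‖ ^ 2 ≤
      12.5 / n * ∑ i, Real.exp ((x i - m i) ^ 2 / 4) := by
  have hlog := two_le_log_of_eight_le hn
  have hn0 : (0 : ℝ) < n := by exact_mod_cast (by omega : 0 < n)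
  have hp0 : (0 : ℝ) < p := by exact_mod_cast hp
  rw [abs_of_nonneg (by linarith)]
  set R := 4 * Cm * Real.sqrt (p * Real.log n) with hR
  have hR0 : 0 ≤ R := by positivity
  have hR2 : R ^ 2 = 16 * Cm ^ 2 * (p * Real.log n) := by
    rw [hR, mul_pow, Real.sq_sqrt (by positivity)]; ring
  rcases le_or_gt ‖x‖ R with hx | hx
  · rw [ballProj_of_norm_le hx]
    rw [sub_self, norm_zero, zero_pow two_ne_zero]
    positivity
  -- `R² ≥ 32 Cm² p` because `log n ≥ 2`, and `32 ≥ 25`.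
  have hmR : 5 * ‖m‖ ≤ R := by
    refine le_of_sq_le_sq ?_ hR0
    have h1 : ‖m‖ ^ 2 ≤ Cm ^ 2 * p := by
      have := pow_le_pow_left₀ (norm_nonneg _) hm 2
      rwa [mul_pow, Real.sq_sqrt hp0.le] at this
    rw [hR2]
    nlinarith [mul_le_mul_of_nonneg_left hlog (show 0 ≤ Cm ^ 2 * p by positivity)]
  set z := x - m with hz
  have hxz : ‖x‖ ≤ ‖z‖ + ‖m‖ := by
    have := norm_add_le z m
    rwa [hz, sub_add_cancel] at this
  have hxz' : 4 * ‖x‖ ≤ 5 * ‖z‖ := by linarith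
  have hx2 : 16 * ‖x‖ ^ 2 ≤ 25 * ‖z‖ ^ 2 := by
    nlinarith [norm_nonneg x, norm_nonneg z]
  have hRx : R ^ 2 ≤ ‖x‖ ^ 2 := pow_le_pow_left₀ hR0 hx.le 2
  set u := ‖z‖ ^ 2 / p with hu
  have hpu : p * u = ‖z‖ ^ 2 := by rw [hu]; field_simp
  -- `‖z‖² ≥ (16 / 25) R²`, and `16 · 16 / 25 > 8`.
  have hul : 8 * Real.log n ≤ u := by
    rw [hu, le_div_iff₀ hp0]
    have : p * Real.log n ≤ Cm ^ 2 * (p * Real.log n) :=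
      le_mul_of_one_le_left (by positivity) (one_le_pow₀ hCm)
    nlinarith
  have h1 : u ≤ 8 * Real.exp (u / 8) := by
    have := Real.add_one_le_exp (u / 8); linarith
  have h2 : Real.exp (u / 8) ≤ Real.exp (u / 4) / n := by
    rw [le_div_iff₀ hn0]
    conv_lhs => rw [← Real.exp_log hn0]
    rw [← Real.exp_add]
    exact Real.exp_le_exp.2 (by linarith)
  have h3 := exp_norm_sq_div_le hp z
  calc ‖ballProj R x - x‖ ^ 2 ≤ ‖x‖ ^ 2 :=
        pow_le_pow_left₀ (norm_nonneg _) (norm_ballProj_sub_le hR0 x) 2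
    _ ≤ 25 / 16 * (p * u) := by rw [hpu]; linarith
    _ ≤ 25 / 16 * (p * (8 * (Real.exp (u / 4) / n))) := by gcongr; linarith
    _ = 12.5 / n * (p * Real.exp (u / 4)) := by ring
    _ ≤ 12.5 / n * ∑ i, Real.exp ((x i - m i) ^ 2 / 4) := by gcongr; exact h3

theorem integral_norm_ballProj_sub_sq_le (hp : 1 ≤ p) (hn : 8 ≤ n) (hCm : 1 ≤ Cm)
    {m : EuclideanSpace ℝ (Fin p)} (hm : ‖m‖ ≤ Cm * Real.sqrt p) :
    Integrable (fun x => ‖ballProj (4 * Cm * Real.sqrt (p * |Real.log n|)) x - x‖ ^ 2)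
        (multivariateGaussian m 1) ∧
      ∫ x, ‖ballProj (4 * Cm * Real.sqrt (p * |Real.log n|)) x - x‖ ^ 2
        ∂(multivariateGaussian m 1) ≤ 25 * p / n := by
  have h := integral_sum_exp_multivariateGaussian m
  have hi : Integrable (fun x => ‖ballProj (4 * Cm * Real.sqrt (p * |Real.log n|)) x - x‖ ^ 2)
        (multivariateGaussian m 1) := by
    refine (h.1.const_mul (12.5 / n)).mono'
      ((((measurable_ballProj _).sub measurable_id).norm.pow_const 2).aestronglyMeasurable)
      (Filter.Eventually.of_forall fun x => ?_)
    rw [Real.norm_of_nonneg (by positivity)]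
    exact norm_ballProj_sub_sq_le hp hn hCm hm x
  refine ⟨hi, (integral_mono hi (h.1.const_mul (12.5 / n)) fun x =>
    norm_ballProj_sub_sq_le hp hn hCm hm x).trans ?_⟩
  rw [integral_const_mul]
  calc 12.5 / n * _ ≤ 12.5 / n * (p * 2 : ℝ) := mul_le_mul_of_nonneg_left h.2 (by positivity)
    _ = 25 * p / n := by ring

theorem integral_norm_ballProj_sub_mean_sq_le {R : ℝ} (hR : 0 ≤ R)
    {m : EuclideanSpace ℝ (Fin p)} (hm : ‖m‖ ≤ Cm * Real.sqrt p) :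
    Integrable (fun x => ‖ballProj R x - m‖ ^ 2) (multivariateGaussian m 1) ∧
      ∫ x, ‖ballProj R x - m‖ ^ 2 ∂(multivariateGaussian m 1) ≤ (2 + 8 * Cm ^ 2) * p := by
  have h := integral_norm_sub_sq_multivariateGaussian m
  have h1 : ‖m‖ ^ 2 ≤ Cm ^ 2 * p := by
    have := pow_le_pow_left₀ (norm_nonneg _) hm 2
    rwa [mul_pow, Real.sq_sqrt (Nat.cast_nonneg _)] at this
  have hpt : ∀ x, ‖ballProj R x - m‖ ^ 2 ≤ 2 * ‖x - m‖ ^ 2 + 8 * Cm ^ 2 * p := by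
    intro x
    have h2 : ‖ballProj R x - m‖ ≤ ‖x - m‖ + 2 * ‖m‖ := by
      have h3 : ‖x‖ ≤ ‖x - m‖ + ‖m‖ := by
        have := norm_add_le (x - m) m
        rwa [sub_add_cancel] at this
      linarith [norm_sub_le (ballProj R x) m, norm_ballProj_le_norm hR x]
    have h4 := pow_le_pow_left₀ (norm_nonneg _) h2 2
    nlinarith [sq_nonneg (‖x - m‖ - 2 * ‖m‖)]
  have hg : Integrable (fun x => 2 * ‖x - m‖ ^ 2 + 8 * Cm ^ 2 * p) (multivariateGaussian m 1) :=
    (h.1.const_mul 2).add (integrable_const _)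
  have hi : Integrable (fun x => ‖ballProj R x - m‖ ^ 2) (multivariateGaussian m 1) := by
    refine hg.mono'
      ((((measurable_ballProj _).sub measurable_const).norm.pow_const 2).aestronglyMeasurable)
      (Filter.Eventually.of_forall fun x => ?_)
    rw [Real.norm_of_nonneg (by positivity)]
    exact hpt x
  refine ⟨hi, (integral_mono hi hg hpt).trans_eq ?_⟩
  rw [integral_add (h.1.const_mul 2) (integrable_const _), integral_const_mul, h.2]
  simp
  ring

end ProjectionBias

/-! ### Integrals against the mixture law of one data point. -/

section PointLaw

variable {K p : ℕ} {μ : Fin K → ℝ} {m : Fin K → EuclideanSpace ℝ (Fin p)}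

theorem isProbabilityMeasure_bayesPointLaw (hμ : ∀ k, 0 ≤ μ k) (hs : ∑ k, μ k = 1) :
    IsProbabilityMeasure (bayesPointLaw μ m) := by
  constructor
  simp only [bayesPointLaw, Measure.finsetSum_apply, Measure.smul_apply, measure_univ, smul_eq_mul,
    mul_one]
  rw [← ENNReal.ofReal_sum_of_nonneg fun k _ => hμ k, hs, ENNReal.ofReal_one]

theorem measurable_ite_label {F : Type*} [MeasurableSpace F] [Zero F] {h : EuclideanSpace ℝ (Fin p) → F}
    (hh : Measurable h) (k : Fin K) :
    Measurable (fun z : LabelledPoint K p => if z.2 = k then h z.1 else 0) :=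
  Measurable.ite (measurable_snd (measurableSet_singleton k)) (hh.comp measurable_fst)
    measurable_const

theorem integral_ite_bayesPointLaw (hμ : ∀ k, 0 ≤ μ k) {h : EuclideanSpace ℝ (Fin p) → ℝ}
    (hh : Measurable h) (k : Fin K) (hi : Integrable h (multivariateGaussian (m k) 1)) :
    ∫ z, (if z.2 = k then h z.1 else 0) ∂(bayesPointLaw μ m) =
      μ k * ∫ x, h x ∂(multivariateGaussian (m k) 1) := by
  have hf := measurable_ite_label hh k
  have hl : ∀ l, Integrable (fun z : LabelledPoint K p => if z.2 = k then h z.1 else 0)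
        ((multivariateGaussian (m l) 1).prod (Measure.dirac l)) ∧
      ∫ z, (if z.2 = k then h z.1 else 0)
        ∂((multivariateGaussian (m l) 1).prod (Measure.dirac l)) =
        if l = k then ∫ x, h x ∂(multivariateGaussian (m k) 1) else 0 := by
    intro l
    rw [Measure.prod_dirac]
    constructor
    · rw [integrable_map_measure hf.aestronglyMeasurable (by fun_prop)]
      by_cases hlk : l = k
      · subst hlk; simpa [Function.comp_def] using hi
      · simp [Function.comp_def, hlk]
    · rw [integral_map (by fun_prop) hf.aestronglyMeasurable]
      by_cases hlk : l = k
      · subst hlk; simp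
      · simp [hlk]
  rw [bayesPointLaw, integral_finsetSum_measure fun l _ => (hl l).1.smul_measure (by simp)]
  simp [integral_smul_measure, (hl _).2, ENNReal.toReal_ofReal (hμ k)]

end PointLaw

/-! ### Second moments of class counts and centred class sums. -/

section ClassSums

variable {K p n : ℕ} {μ : Fin K → ℝ} {m : Fin K → EuclideanSpace ℝ (Fin p)}

theorem le_one_of_sum_eq_one (hμ : ∀ k, 0 ≤ μ k) (hs : ∑ k, μ k = 1) (k : Fin K) : μ k ≤ 1 := by
  rw [← hs]; exact Finset.single_le_sum (fun l _ => hμ l) (Finset.mem_univ k)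

theorem integral_card_classIndices_sub_sq_le (hμ : ∀ k, 0 ≤ μ k) (hs : ∑ k, μ k = 1)
    (k : Fin K) :
    Integrable (fun X : Fin n → LabelledPoint K p =>
        ((classIndices X k).card - n * μ k) ^ 2) (Measure.pi fun _ => bayesPointLaw μ m) ∧
      ∫ X : Fin n → LabelledPoint K p, ((classIndices X k).card - n * μ k) ^ 2
        ∂(Measure.pi fun _ => bayesPointLaw μ m) ≤ n := by
  have := isProbabilityMeasure_bayesPointLaw (m := m) hμ hs
  have hk0 := hμ k
  have hk1 := le_one_of_sum_eq_one hμ hs k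
  set f : LabelledPoint K p → ℝ := fun z => (if z.2 = k then 1 else 0) - μ k with hf
  have hmi : Measurable (fun z : LabelledPoint K p => if z.2 = k then (1 : ℝ) else 0) :=
    measurable_ite_label (h := fun _ => (1 : ℝ)) measurable_const k
  have hmf : Measurable f := hmi.sub measurable_const
  have hb : ∀ z, |f z| ≤ 1 := by
    intro z
    simp only [hf, abs_le]
    split_ifs <;> constructor <;> linarith
  have hL : MemLp f 2 (bayesPointLaw μ m) :=
    MemLp.of_bound hmf.aestronglyMeasurable 1 (Filter.Eventually.of_forall hb)
  have h0 : ∫ z, f z ∂(bayesPointLaw μ m) = 0 := by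
    have hi : Integrable (fun z : LabelledPoint K p => if z.2 = k then (1 : ℝ) else 0)
        (bayesPointLaw μ m) := by
      refine Integrable.of_bound hmi.aestronglyMeasurable 1 (Filter.Eventually.of_forall fun z => ?_)
      split_ifs <;> simp
    rw [integral_sub hi (integrable_const _),
      integral_ite_bayesPointLaw (h := fun _ => (1 : ℝ)) hμ measurable_const k
        (integrable_const _)]
    simp
  have h1 : ∫ z, f z ^ 2 ∂(bayesPointLaw μ m) ≤ 1 := by
    calc ∫ z, f z ^ 2 ∂(bayesPointLaw μ m) ≤ ∫ _, 1 ∂(bayesPointLaw μ m) :=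
          integral_mono hL.integrable_sq (integrable_const _) fun z => by
            simpa using (sq_le_one_iff_abs_le_one _).2 (hb z)
      _ = 1 := by simp
  have h := integral_sq_sum_pi_le (bayesPointLaw μ m) hL n
  have he : ∀ X : Fin n → LabelledPoint K p,
      ∑ j, f (X j) = (classIndices X k).card - n * μ k := by
    intro X
    simp [hf, classIndices, Finset.sum_sub_distrib]
  simp_rw [he, h0] at h
  refine ⟨h.1, h.2.trans ?_⟩
  have := mul_le_mul_of_nonneg_left h1 (Nat.cast_nonneg (α := ℝ) n)
  linarith

theorem sq_integral_le_integral_sq {Z : Type*} [MeasurableSpace Z] (P : Measure Z)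
    [IsProbabilityMeasure P] {f : Z → ℝ} (hf : MemLp f 2 P) :
    (∫ z, f z ∂P) ^ 2 ≤ ∫ z, f z ^ 2 ∂P := by
  have h := variance_nonneg f P
  rw [variance_eq_sub hf] at h
  simpa using h

/-- Label indicators turn the sum over a random index set into an i.i.d. sum in each coordinate. The
fluctuation contributes `n` times order `p`, and the bias contributes `n²` times `25 p / n`. -/
theorem integral_norm_sum_classIndices_sq_le {Cm : ℝ} (hμ : ∀ k, 0 ≤ μ k) (hs : ∑ k, μ k = 1)
    (hp : 1 ≤ p) (hn : 8 ≤ n) (hCm : 1 ≤ Cm) (k : Fin K) (hm : ‖m k‖ ≤ Cm * Real.sqrt p)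
    {R : ℝ} (hR : R = 4 * Cm * Real.sqrt (p * |Real.log n|)) :
    Integrable (fun X : Fin n → LabelledPoint K p =>
        ‖∑ j ∈ classIndices X k, (ballProj R (X j).1 - m k)‖ ^ 2)
        (Measure.pi fun _ => bayesPointLaw μ m) ∧
      ∫ X : Fin n → LabelledPoint K p, ‖∑ j ∈ classIndices X k, (ballProj R (X j).1 - m k)‖ ^ 2
        ∂(Measure.pi fun _ => bayesPointLaw μ m) ≤ n * p * (27 + 8 * Cm ^ 2) := by
  have := isProbabilityMeasure_bayesPointLaw (m := m) hμ hs
  have hn0 : (0 : ℝ) < n := by exact_mod_cast (by omega : 0 < n)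
  have hk0 := hμ k
  have hk1 := le_one_of_sum_eq_one hμ hs k
  have hR0 : 0 ≤ R := by rw [hR]; positivity
  set ν := multivariateGaussian (m k) 1 with hν
  have hA := integral_norm_ballProj_sub_mean_sq_le hR0 hm
  have hB := integral_norm_ballProj_sub_sq_le hp hn hCm hm
  rw [← hR] at hB
  set h : Fin p → EuclideanSpace ℝ (Fin p) → ℝ := fun i x => ballProj R x i - m k i with hh
  have hmh : ∀ i, Measurable (h i) := fun i => by
    have := measurable_ballProj (E := EuclideanSpace ℝ (Fin p)) R
    fun_prop
  have hbh : ∀ i x, ‖h i x‖ ≤ R + ‖m k‖ := fun i x =>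
    (PiLp.norm_apply_le (ballProj R x - m k) i).trans
      ((norm_sub_le _ _).trans (add_le_add_left (norm_ballProj_le hR0 x) _))
  have hLh : ∀ i, MemLp (h i) 2 ν := fun i =>
    MemLp.of_bound (hmh i).aestronglyMeasurable _ (Filter.Eventually.of_forall (hbh i))
  set w : Fin p → LabelledPoint K p → ℝ := fun i z => if z.2 = k then h i z.1 else 0 with hw
  have hLw : ∀ i, MemLp (w i) 2 (bayesPointLaw μ m) := fun i => by
    refine MemLp.of_bound (measurable_ite_label (hmh i) k).aestronglyMeasurable (R + ‖m k‖)
      (Filter.Eventually.of_forall fun z => ?_)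
    simp only [hw]
    split_ifs
    · exact hbh i _
    · simpa using by positivity
  have hw2 : ∀ i, ∫ z, w i z ^ 2 ∂(bayesPointLaw μ m) ≤ ∫ x, h i x ^ 2 ∂ν := fun i => by
    have := integral_ite_bayesPointLaw hμ (m := m) ((hmh i).pow_const 2) k (hLh i).integrable_sq
    have he : ∀ z, w i z ^ 2 = if z.2 = k then h i z.1 ^ 2 else 0 := fun z => by
      simp only [hw]; split_ifs <;> simp
    simp_rw [he, this]
    exact mul_le_of_le_one_left (integral_nonneg fun _ => sq_nonneg _) hk1
  have hsum2 : ∑ i, ∫ x, h i x ^ 2 ∂ν ≤ (2 + 8 * Cm ^ 2) * p := by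
    rw [← integral_finsetSum _ fun i _ => (hLh i).integrable_sq]
    refine le_of_eq_of_le (integral_congr_ae (Filter.Eventually.of_forall fun x => ?_)) hA.2
    simp only [hh, EuclideanSpace.norm_sq_eq, Real.norm_eq_abs, sq_abs, PiLp.sub_apply]
  have hLc : ∀ i, MemLp (fun x : EuclideanSpace ℝ (Fin p) => x i - m k i) 2 ν := fun i => by
    have hm' : Measurable fun x : EuclideanSpace ℝ (Fin p) => x i - m k i := by fun_prop
    rw [memLp_two_iff_integrable_sq hm'.aestronglyMeasurable]
    exact (integral_eval_sub_multivariateGaussian (m k) i (f := fun x => x ^ 2)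
      (by fun_prop) integral_sq_gaussianReal.1).1
  have hLb : ∀ i, MemLp (fun x : EuclideanSpace ℝ (Fin p) => ballProj R x i - x i) 2 ν := fun i => by
    refine ((hLh i).sub (hLc i)).ae_eq (Filter.Eventually.of_forall fun x => ?_)
    simp [hh]
  -- The unprojected feature has mean `m k`, so what remains is pure projection bias.
  have hmean : ∀ i, ∫ x, h i x ∂ν = ∫ x, (ballProj R x i - x i) ∂ν := fun i => by
    have h1 := (integral_eval_sub_multivariateGaussian (m k) i (f := fun x => x)
      (by fun_prop) IsGaussian.integrable_fun_id)
    rw [integral_id_gaussianReal] at h1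
    have h2 : ∀ x, h i x = (ballProj R x i - x i) + (x i - m k i) := fun x => by
      simp [hh]
    simp_rw [h2]
    rw [integral_add ((hLb i).integrable (by norm_num)) ((hLc i).integrable (by norm_num)), h1.2,
      add_zero]
  have hw1 : ∀ i, (∫ z, w i z ∂(bayesPointLaw μ m)) ^ 2 ≤
      ∫ x, (ballProj R x i - x i) ^ 2 ∂ν := fun i => by
    rw [integral_ite_bayesPointLaw hμ (hmh i) k ((hLh i).integrable (by norm_num)), ← hν, hmean,
      mul_pow]
    have := sq_integral_le_integral_sq ν (hLb i)
    exact (mul_le_of_le_one_left (sq_nonneg _) (pow_le_one₀ hk0 hk1)).trans this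
  have hsum1 : ∑ i, ∫ x, (ballProj R x i - x i) ^ 2 ∂ν ≤ 25 * p / n := by
    rw [← integral_finsetSum _ fun i _ => (hLb i).integrable_sq]
    refine le_of_eq_of_le (integral_congr_ae (Filter.Eventually.of_forall fun x => ?_)) hB.2
    simp only [EuclideanSpace.norm_sq_eq, Real.norm_eq_abs, sq_abs, PiLp.sub_apply]
  have hS := fun i => integral_sq_sum_pi_le (bayesPointLaw μ m) (hLw i) n
  have he : ∀ X : Fin n → LabelledPoint K p,
      ‖∑ j ∈ classIndices X k, (ballProj R (X j).1 - m k)‖ ^ 2 = ∑ i, (∑ j, w i (X j)) ^ 2 := by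
    intro X
    rw [EuclideanSpace.norm_sq_eq]
    refine Finset.sum_congr rfl fun i _ => ?_
    rw [Real.norm_eq_abs, sq_abs, classIndices, Finset.sum_filter]
    congr 1
    rw [WithLp.ofLp_sum, Finset.sum_apply]
    refine Finset.sum_congr rfl fun j _ => ?_
    simp only [hw, hh]
    split_ifs <;> simp
  simp_rw [he]
  refine ⟨integrable_finsetSum _ fun i _ => (hS i).1, ?_⟩
  rw [integral_finsetSum _ fun i _ => (hS i).1]
  calc _ ≤ ∑ i, (n * ∫ x, h i x ^ 2 ∂ν + n ^ 2 * ∫ x, (ballProj R x i - x i) ^ 2 ∂ν) := by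
        refine Finset.sum_le_sum fun i _ => (hS i).2.trans ?_
        exact add_le_add (mul_le_mul_of_nonneg_left (hw2 i) hn0.le)
          (mul_le_mul_of_nonneg_left (hw1 i) (by positivity))
    _ = n * ∑ i, ∫ x, h i x ^ 2 ∂ν + n ^ 2 * ∑ i, ∫ x, (ballProj R x i - x i) ^ 2 ∂ν := by
        rw [Finset.sum_add_distrib, Finset.mul_sum, Finset.mul_sum]
    _ ≤ n * ((2 + 8 * Cm ^ 2) * p) + n ^ 2 * (25 * p / n) := by gcongr
    _ = n * p * (27 + 8 * Cm ^ 2) := by field_simp; ring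

end ClassSums

/-! ### The error of the noisy release. -/

section GaussianRelease

variable {E : Type*} [NormedAddCommGroup E] [InnerProductSpace ℝ E] [FiniteDimensional ℝ E]
  [MeasurableSpace E] [BorelSpace E]

theorem lintegral_norm_sub_sq_gaussianRelease_le (ε δ α : ℝ) (θ θ₀ : E) :
    ∫⁻ t, ENNReal.ofReal (‖t - θ₀‖ ^ 2) ∂(gaussianRelease ε δ α θ) ≤
      ENNReal.ofReal (2 * ‖θ - θ₀‖ ^ 2 +
        2 * (2 * α / ε * Real.sqrt (2 * Real.log (1.25 / δ))) ^ 2 * Module.finrank ℝ E) := by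
  rw [gaussianRelease]
  set s := 2 * α / ε * Real.sqrt (2 * Real.log (1.25 / δ))
  have hG := integral_norm_sq_stdGaussian (E := E)
  have hi : Integrable (fun ζ : E => 2 * ‖θ - θ₀‖ ^ 2 + 2 * s ^ 2 * ‖ζ‖ ^ 2)
      (stdGaussian E) := (integrable_const _).add (hG.1.const_mul _)
  have hval : ∫ ζ, (2 * ‖θ - θ₀‖ ^ 2 + 2 * s ^ 2 * ‖ζ‖ ^ 2) ∂(stdGaussian E) =
      2 * ‖θ - θ₀‖ ^ 2 + 2 * s ^ 2 * Module.finrank ℝ E := by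
    rw [integral_add (integrable_const _) (hG.1.const_mul _), integral_const_mul (2 * s ^ 2), hG.2]
    simp
  rw [lintegral_map (by fun_prop) (by fun_prop), ← hval, ofReal_integral_eq_lintegral_ofReal hi
      (Filter.Eventually.of_forall fun ζ => by positivity)]
  refine lintegral_mono fun ζ => ENNReal.ofReal_le_ofReal ?_
  rw [add_sub_right_comm]
  have h1 := norm_add_le (θ - θ₀) (s • ζ)
  have h2 := pow_le_pow_left₀ (norm_nonneg _) h1 2
  rw [norm_smul, Real.norm_eq_abs] at h2
  have h3 : (|s| * ‖ζ‖) ^ 2 = s ^ 2 * ‖ζ‖ ^ 2 := by rw [mul_pow, sq_abs]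
  nlinarith [sq_nonneg (‖θ - θ₀‖ - |s| * ‖ζ‖)]

end GaussianRelease

/-! ### Stability of clipping and normalization. -/

section Augment

variable {K p : ℕ} {μ : Fin K → ℝ} {m : Fin K → EuclideanSpace ℝ (Fin p)} {c₀ : ℝ}

theorem card_mul_le_one (hμ : ∀ k, 2 * c₀ < μ k) (hs : ∑ k, μ k = 1) : K * c₀ ≤ 1 / 2 := by
  have h : ∑ _k : Fin K, 2 * c₀ ≤ ∑ k, μ k := Finset.sum_le_sum fun k _ => (hμ k).le
  rw [hs] at h
  simp at h
  linarith

theorem nonempty_of_sum_eq_one (hs : ∑ k, μ k = 1) : Nonempty (Fin K) := by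
  by_contra h
  rw [not_nonempty_iff] at h
  simp at hs

/-- Clipping is 1-Lipschitz and fixes `μ`, so it does not increase the error. Normalization divides
by `S ≥ c₀`, where `S - 1` is the sum of the clipped errors, and Cauchy–Schwarz with `K ≤ 1 / c₀`
controls it. -/
theorem bayesSqError_bayesAugment_le (hc₀ : 0 < c₀) (hμ : ∀ k, 2 * c₀ < μ k) (hs : ∑ k, μ k = 1)
    (t : BayesParam K p) :
    bayesSqError μ m (bayesAugment c₀ t) ≤
      (1 + 2 / c₀ ^ 2 * (1 + 1 / c₀)) * bayesSqError μ m t := by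
  obtain ⟨k₀⟩ := nonempty_of_sum_eq_one hs
  have hK : (K : ℝ) ≤ 1 / c₀ := by
    rw [le_div_iff₀ hc₀]; linarith [card_mul_le_one hμ hs]
  have hμ0 : ∀ k, 0 ≤ μ k := fun k => by linarith [hμ k]
  set a : Fin K → ℝ := fun k => max (t.fst k) c₀ with ha
  have hac : ∀ k, c₀ ≤ a k := fun k => le_max_right _ _
  set d : Fin K → ℝ := fun k => a k - μ k with hd
  have hdt : ∀ k, d k ^ 2 ≤ |t.fst k - μ k| ^ 2 := fun k => by
    rw [← sq_abs]
    have h : max (μ k) c₀ = μ k := max_eq_left (by linarith [hμ k])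
    have := abs_max_sub_max_le_abs (t.fst k) (μ k) c₀
    rw [h] at this
    exact pow_le_pow_left₀ (abs_nonneg _) this 2
  set S := ∑ j, a j with hS
  have hSc : c₀ ≤ S := (hac k₀).trans
    (Finset.single_le_sum (f := a) (fun l _ => hc₀.le.trans (hac l)) (Finset.mem_univ k₀))
  have hS0 : 0 < S := hc₀.trans_le hSc
  have hS1 : S - 1 = ∑ j, d j := by rw [hd, Finset.sum_sub_distrib, hs]
  set D := ∑ j, d j ^ 2 with hD
  have hD0 : 0 ≤ D := Finset.sum_nonneg fun _ _ => sq_nonneg _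
  have hSD : (S - 1) ^ 2 ≤ 1 / c₀ * D := by
    rw [hS1]
    have := sq_sum_le_card_mul_sum_sq (s := Finset.univ) (f := d)
    rw [Finset.card_univ, Fintype.card_fin] at this
    exact this.trans (mul_le_mul_of_nonneg_right hK hD0)
  have hk : ∀ k, |a k / S - μ k| ^ 2 ≤ 2 / c₀ ^ 2 * (d k ^ 2 + μ k * (1 / c₀ * D)) := fun k => by
    have h1 : a k / S - μ k = (d k + μ k * (1 - S)) / S := by
      simp only [hd]; field_simp; ring
    rw [sq_abs, h1, div_pow, div_le_iff₀ (by positivity)]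
    have h2 : (d k + μ k * (1 - S)) ^ 2 ≤ 2 * (d k ^ 2 + μ k * (1 / c₀ * D)) := by
      have h3 : (μ k * (1 - S)) ^ 2 ≤ μ k * (1 / c₀ * D) := by
        have hk1 := le_one_of_sum_eq_one hμ0 hs k
        rw [mul_pow]
        -- Weakening `μ k ^ 2` to `μ k` lets `∑ μ = 1` close the sum over classes without another
        -- factor `K`.
        refine mul_le_mul (pow_le_of_le_one (hμ0 k) hk1 two_ne_zero) ?_ (sq_nonneg _) (hμ0 k)
        rw [show (1 - S) ^ 2 = (S - 1) ^ 2 by ring]; exact hSD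
      nlinarith [sq_nonneg (d k - μ k * (1 - S))]
    have h4 : 1 ≤ S ^ 2 / c₀ ^ 2 := by
      rw [one_le_div (by positivity)]; exact pow_le_pow_left₀ hc₀.le hSc 2
    have h5 : 0 ≤ 2 * (d k ^ 2 + μ k * (1 / c₀ * D)) := by
      have := hμ0 k
      positivity
    calc _ ≤ _ := h2
      _ ≤ (2 * (d k ^ 2 + μ k * (1 / c₀ * D))) * (S ^ 2 / c₀ ^ 2) := le_mul_of_one_le_right h5 h4
      _ = _ := by ring
  have hDt : D ≤ ∑ k, |t.fst k - μ k| ^ 2 := Finset.sum_le_sum fun k _ => hdt k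
  have hfst : ∑ k, |a k / S - μ k| ^ 2 ≤
      2 / c₀ ^ 2 * (1 + 1 / c₀) * ∑ k, |t.fst k - μ k| ^ 2 := by
    calc _ ≤ ∑ k, 2 / c₀ ^ 2 * (d k ^ 2 + μ k * (1 / c₀ * D)) := Finset.sum_le_sum fun k _ => hk k
      _ = 2 / c₀ ^ 2 * (1 + 1 / c₀) * D := by
          rw [← Finset.mul_sum, Finset.sum_add_distrib, ← Finset.sum_mul, hs]; ring
      _ ≤ _ := by gcongr
  have hl : bayesSqError μ m (bayesAugment c₀ t) =
      ∑ k, |a k / S - μ k| ^ 2 + ∑ k, ‖t.snd k - m k‖ ^ 2 := by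
    rw [bayesSqError, Finset.sum_add_distrib]; rfl
  rw [hl, bayesSqError, Finset.sum_add_distrib]
  have h1 : 0 ≤ ∑ k, |t.fst k - μ k| ^ 2 := Finset.sum_nonneg fun _ _ => by positivity
  have h2 : 0 ≤ ∑ k, ‖t.snd k - m k‖ ^ 2 := Finset.sum_nonneg fun _ _ => by positivity
  have h3 : 0 ≤ 2 / c₀ ^ 2 * (1 + 1 / c₀) := by positivity
  nlinarith [mul_nonneg h3 h2]

theorem bayesSqError_nonneg (μ : Fin K → ℝ) (m : Fin K → EuclideanSpace ℝ (Fin p))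
    (t : BayesParam K p) : 0 ≤ bayesSqError μ m t := by
  unfold bayesSqError; positivity

theorem measurable_bayesSqError (μ : Fin K → ℝ) (m : Fin K → EuclideanSpace ℝ (Fin p)) :
    Measurable (bayesSqError μ m) := by
  have h : bayesSqError μ m = fun t => ‖t - bayesParam μ m‖ ^ 2 :=
    funext fun t => (norm_sub_bayesParam_sq μ m t).symm
  rw [h]
  fun_prop

theorem finrank_bayesParam : (Module.finrank ℝ (BayesParam K p) : ℝ) = K + K * p := by
  rw [(WithLp.linearEquiv 2 ℝ (EuclideanSpace ℝ (Fin K) ×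
    PiLp 2 (fun _ : Fin K => EuclideanSpace ℝ (Fin p)))).finrank_eq, Module.finrank_prod,
    finrank_euclideanSpace_fin,
    (WithLp.linearEquiv 2 ℝ (Fin K → EuclideanSpace ℝ (Fin p))).finrank_eq,
    Module.finrank_pi_fintype]
  simp

end Augment

/-! ### Consequences of the sample-size condition. -/

section ParameterRegime

variable {n : ℕ} {c₀ ε δ : ℝ}

/-- The point of `δ ≤ ε` is that the maximum in `ePTRThreshold` is then `1 / δ`. If it failed, `1 /
ε` would exceed `n` and the sample-size condition would force `c₀ n ≥ 8 n`. -/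
theorem sample_size_bounds (hc₀ : 0 < c₀) (hc₁ : c₀ ≤ 1 / 2) (hε : 0 < ε) (hδ : 0 < δ)
    (hδn : δ < 1 / (n : ℝ) ^ 3) (hn : 4 / c₀ + 8 / (c₀ * ε) * Real.log (1 / δ) ≤ n) :
    8 ≤ n ∧ δ ≤ 1 / (n : ℝ) ^ 3 ∧ 0 < Real.log (1 / δ) ∧ δ ≤ ε ∧
      4 + 8 / ε * Real.log (1 / δ) ≤ c₀ * n := by
  -- For `n = 0` the bound on `δ` reads `δ < 1 / 0 = 0`.
  have hn0 : (n : ℝ) ≠ 0 := by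
    intro h
    rw [h] at hδn
    norm_num at hδn
    linarith
  have hn1 : (1 : ℝ) ≤ n := by
    exact_mod_cast Nat.one_le_iff_ne_zero.2 (by exact_mod_cast hn0)
  have hn3 : (1 : ℝ) ≤ (n : ℝ) ^ 3 := one_le_pow₀ hn1
  have hδ3 : (n : ℝ) ^ 3 < 1 / δ := by
    rw [lt_one_div (by positivity) hδ]; exact hδn
  have hlog : 0 < Real.log (1 / δ) := Real.log_pos (by linarith)
  have hmain : 4 + 8 / ε * Real.log (1 / δ) ≤ c₀ * n := by
    have := mul_le_mul_of_nonneg_left hn hc₀.le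
    calc _ = c₀ * (4 / c₀ + 8 / (c₀ * ε) * Real.log (1 / δ)) := by field_simp
      _ ≤ _ := this
  have hpos : 0 < 8 / ε * Real.log (1 / δ) := by positivity
  have hn8 : (8 : ℝ) ≤ n := by nlinarith
  have hn8' : 8 ≤ n := by exact_mod_cast hn8
  refine ⟨hn8', hδn.le, hlog, ?_, hmain⟩
  by_contra hlt
  rw [not_le] at hlt
  have hl1 : 1 ≤ Real.log (1 / δ) := by
    have h2 := two_le_log_of_eight_le hn8'
    have h3 : Real.log n ≤ Real.log (1 / δ) := Real.log_le_log (by positivity)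
      ((le_self_pow₀ hn1 (by norm_num)).trans hδ3.le)
    linarith
  have he : (n : ℝ) ≤ 1 / ε := by
    have h1 : 1 / δ ≤ 1 / ε := one_div_le_one_div_of_le hε hlt.le
    exact (le_self_pow₀ hn1 (by norm_num)).trans (hδ3.le.trans h1)
  have h8 : 8 / ε * 1 ≤ 8 / ε * Real.log (1 / δ) := by gcongr
  have h9 : 8 / ε = 8 * (1 / ε) := by ring
  nlinarith

theorem one_sub_ePTRReleaseProb_le (hε : 0 < ε) (hδ : 0 < δ) (hδε : δ ≤ ε) {g : ℝ}
    (hg : 1 + 4 / ε * Real.log (1 / δ) ≤ g) : 1 - ePTRReleaseProb ε δ g ≤ δ := by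
  refine (one_sub_ePTRReleaseProb_le_exp ε δ g).trans ?_
  have hM : ePTRThreshold ε δ = 1 + 2 / ε * Real.log (1 / δ) := by
    rw [ePTRThreshold, max_eq_left (one_div_le_one_div_of_le hδ hδε)]
  have h1 : 2 / ε * Real.log (1 / δ) ≤ g - ePTRThreshold ε δ := by
    rw [hM]
    have : 4 / ε * Real.log (1 / δ) = 2 / ε * Real.log (1 / δ) + 2 / ε * Real.log (1 / δ) := by
      ring
    linarith
  have h2 := mul_le_mul_of_nonneg_left h1 hε.le
  have h3 : ε * (2 / ε * Real.log (1 / δ)) = 2 * Real.log (1 / δ) := by field_simp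
  have h4 : Real.log (1 / δ) = -Real.log δ := by rw [one_div, Real.log_inv]
  calc _ ≤ Real.exp (Real.log δ) := Real.exp_le_exp.2 (by linarith)
    _ = δ := Real.exp_log hδ

theorem noise_scale_sq_le {p : ℕ} {Cm R : ℝ} (hp : 1 ≤ p) (hn : 8 ≤ n) (hc₀ : 0 < c₀)
    (hε : 0 < ε) (hδ : 0 < δ) (hδn : δ ≤ 1 / (n : ℝ) ^ 3)
    (hR : R ^ 2 = 16 * Cm ^ 2 * (p * Real.log n)) :
    (2 * bayesSensitivity n R c₀ / ε * Real.sqrt (2 * Real.log (1.25 / δ))) ^ 2 ≤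
      64 * (32 * Cm ^ 2 / c₀ ^ 2 + 2) *
        (p * Real.log n * Real.log (1 / δ) / (ε ^ 2 * n ^ 2)) := by
  have hn8 : (8 : ℝ) ≤ n := by exact_mod_cast hn
  have hp1 : (1 : ℝ) ≤ p := by exact_mod_cast hp
  have hlogn := two_le_log_of_eight_le hn
  have hδ8 : δ ≤ 1 / 8 := by
    refine hδn.trans (one_div_le_one_div_of_le (by norm_num) ?_)
    exact hn8.trans (le_self_pow₀ (by linarith) (by norm_num))
  have h125 : 1.25 ≤ 1 / δ := by
    rw [le_one_div (by norm_num) hδ]; norm_num; linarith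
  have hlog : Real.log (1.25 / δ) ≤ 2 * Real.log (1 / δ) := by
    rw [show 1.25 / δ = 1.25 * (1 / δ) by ring, Real.log_mul (by norm_num) (by positivity)]
    have := Real.log_le_log (by norm_num) h125
    linarith
  have hlog0 : 0 ≤ Real.log (1.25 / δ) := by
    refine Real.log_nonneg ?_
    rw [le_div_iff₀ hδ]; linarith
  have hlog1 : 0 ≤ Real.log (1 / δ) := by linarith
  have hpl : 1 ≤ p * Real.log n := by nlinarith
  rw [mul_pow, Real.sq_sqrt (by positivity), div_pow, mul_pow, bayesSensitivity, mul_pow,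
    Real.sq_sqrt (by positivity), div_pow, hR]
  have hα : 2 * (16 * Cm ^ 2 * (p * Real.log n)) / c₀ ^ 2 + 2 ≤
      (32 * Cm ^ 2 / c₀ ^ 2 + 2) * (p * Real.log n) := by
    have : 2 * (16 * Cm ^ 2 * (p * Real.log n)) / c₀ ^ 2 =
      32 * Cm ^ 2 / c₀ ^ 2 * (p * Real.log n) := by ring
    rw [this]; linarith
  -- The constant is `64 = 2² · 2² · 4`, the last factor from `2 log (1.25 / δ) ≤ 4 log (1 / δ)`.
  calc 2 ^ 2 * (2 ^ 2 / (n : ℝ) ^ 2 * (2 * (16 * Cm ^ 2 * (p * Real.log n)) / c₀ ^ 2 + 2)) /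
        ε ^ 2 * (2 * Real.log (1.25 / δ))
      ≤ 2 ^ 2 * (2 ^ 2 / (n : ℝ) ^ 2 * ((32 * Cm ^ 2 / c₀ ^ 2 + 2) * (p * Real.log n))) /
        ε ^ 2 * (2 * (2 * Real.log (1 / δ))) := by gcongr
    _ = _ := by field_simp; ring

end ParameterRegime

/-! ### The risk bound. -/

section Risk

variable {K p n : ℕ} {μ : Fin K → ℝ} {m : Fin K → EuclideanSpace ℝ (Fin p)} {c₀ ε δ Cm R : ℝ}

/-- A pointwise Chebyshev bound. If all counts reach `(3 / 2) c₀ n`, the sub-distance is at least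
`c₀ n / 2 - 1` and the fallback has probability at most `δ`. Otherwise some count misses its mean,
above `2 c₀ n`, by more than `c₀ n / 2`, and the second term is at least 1. -/
theorem one_sub_releaseProb_le (hε : 0 < ε) (hδ : 0 < δ) (hδε : δ ≤ ε)
    (hδn : δ ≤ 1 / n) (hn : 4 + 8 / ε * Real.log (1 / δ) ≤ c₀ * n) (hμ : ∀ k, 2 * c₀ < μ k)
    (hs : ∑ k, μ k = 1) (X : Fin n → LabelledPoint K p) :
    1 - ePTRReleaseProb ε δ (bayesSubDist c₀ X) ≤
      1 / n + 4 / (c₀ * n) ^ 2 * ∑ k, ((classIndices X k).card - n * μ k) ^ 2 := by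
  have := nonempty_of_sum_eq_one hs
  have hnn : (0 : ℝ) ≤ n := Nat.cast_nonneg n
  by_cases h : ∀ k, 3 / 2 * (c₀ * n) ≤ (classIndices X k).card
  · have h1 : 3 / 2 * (c₀ * n) ≤ ⨅ k : Fin K, ((classIndices X k).card : ℝ) := le_ciInf h
    have h2 : 1 + 4 / ε * Real.log (1 / δ) ≤ bayesSubDist c₀ X := by
      refine le_trans ?_ (le_max_left _ _)
      have : 8 / ε * Real.log (1 / δ) = 4 / ε * Real.log (1 / δ) + 4 / ε * Real.log (1 / δ) := by
        ring
      linarith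
    have h3 : 0 ≤ 4 / (c₀ * n) ^ 2 * ∑ k, ((classIndices X k).card - n * μ k) ^ 2 := by positivity
    linarith [one_sub_ePTRReleaseProb_le hε hδ hδε h2]
  · obtain ⟨k, hk⟩ := not_forall.1 h
    rw [not_le] at hk
    have hpos : 0 < c₀ * n := by
      by_contra hc
      have : (0 : ℝ) ≤ (classIndices X k).card := Nat.cast_nonneg _
      linarith
    have h1 : (c₀ * n / 2) ^ 2 ≤ ((classIndices X k).card - n * μ k) ^ 2 := by
      have h2 : c₀ * n / 2 ≤ n * μ k - (classIndices X k).card := by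
        have := mul_le_mul_of_nonneg_left (hμ k).le hnn
        linarith
      have h3 := pow_le_pow_left₀ (by positivity) h2 2
      rwa [sub_sq_comm] at h3
    have h2 : ((classIndices X k).card - n * μ k) ^ 2 ≤
        ∑ k, ((classIndices X k).card - n * μ k) ^ 2 :=
      Finset.single_le_sum (f := fun k => ((classIndices X k).card - n * μ k) ^ 2)
        (fun _ _ => sq_nonneg _) (Finset.mem_univ k)
    have h3 : 1 ≤ 4 / (c₀ * n) ^ 2 * ∑ k, ((classIndices X k).card - n * μ k) ^ 2 := by
      have hy : ∀ y : ℝ, 0 < y → 1 = 4 / y ^ 2 * (y / 2) ^ 2 := fun y hy => by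
        field_simp; norm_num
      calc (1 : ℝ) = 4 / (c₀ * n) ^ 2 * (c₀ * n / 2) ^ 2 := hy _ hpos
        _ ≤ _ := by gcongr; exact h1.trans h2
    have h4 := ePTRReleaseProb_pos ε δ (bayesSubDist c₀ X)
    have h5 : 0 ≤ 1 / (n : ℝ) := by positivity
    linarith

/-- At positive sub-distance the class has more than `c₀ n` points, which bounds the random
denominator. At zero, a release probability of at most `n⁻³` compensates for the crude error bound
coming from `R`. -/
theorem releaseProb_mul_norm_sampleMean_sub_sq_le (hc₀ : 0 < c₀) (hε : 0 < ε) (hδ : 0 < δ)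
    (hn : 8 ≤ n) (hδn : δ ≤ 1 / (n : ℝ) ^ 3) {k : Fin K} (hm : ‖m k‖ ≤ Cm * Real.sqrt p)
    (hR0 : 0 ≤ R) (hR : R ^ 2 = 16 * Cm ^ 2 * (p * Real.log n))
    (X : Fin n → LabelledPoint K p) :
    ePTRReleaseProb ε δ (bayesSubDist c₀ X) * ‖sampleMean R X k - m k‖ ^ 2 ≤
      1 / (c₀ * n) ^ 2 * ‖∑ j ∈ classIndices X k, (ballProj R (X j).1 - m k)‖ ^ 2 +
        34 * Cm ^ 2 * p / n := by
  have hn8 : (8 : ℝ) ≤ n := by exact_mod_cast hn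
  have hn0 : (0 : ℝ) < n := by linarith
  set q := ePTRReleaseProb ε δ (bayesSubDist c₀ X) with hq
  have hq0 : 0 < q := ePTRReleaseProb_pos _ _ _
  have hq1 : q ≤ 1 := by linarith [one_sub_ePTRReleaseProb_pos ε δ (bayesSubDist c₀ X)]
  set V := ‖∑ j ∈ classIndices X k, (ballProj R (X j).1 - m k)‖ with hV
  have hm2 : ‖m k‖ ^ 2 ≤ Cm ^ 2 * p := by
    have := pow_le_pow_left₀ (norm_nonneg _) hm 2
    rwa [mul_pow, Real.sq_sqrt (Nat.cast_nonneg _)] at this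
  have hg0 : 0 ≤ bayesSubDist c₀ X := le_max_right _ _
  rcases hg0.eq_or_lt with h0 | hpos
  · have hqδ : q ≤ 1 / (n : ℝ) ^ 3 := by
      rw [hq, ← h0]; exact (ePTRReleaseProb_zero_le hε hδ).trans hδn
    have hsm : ‖sampleMean R X k‖ ≤ R := by
      rw [sampleMean, norm_smul, norm_inv, Real.norm_of_nonneg (Nat.cast_nonneg _)]
      refine inv_mul_le_of_le_mul₀ (Nat.cast_nonneg _) hR0 ?_
      refine (norm_sum_le_of_le _ fun j _ => norm_ballProj_le hR0 (X j).1).trans_eq ?_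
      simp
    -- `34 = 2 · 16 + 2`, with `log n ≤ n` in `R²` and `1 ≤ n` in `‖m k‖²`.
    have h2 : ‖sampleMean R X k - m k‖ ^ 2 ≤ 34 * Cm ^ 2 * p * n := by
      have h3 := pow_le_pow_left₀ (norm_nonneg _) (norm_sub_le (sampleMean R X k) (m k)) 2
      have h4 := pow_le_pow_left₀ (norm_nonneg _) hsm 2
      have hlog : Real.log n ≤ n := (Real.log_le_sub_one_of_pos hn0).trans (by linarith)
      have h5 : Cm ^ 2 * (p * Real.log n) ≤ Cm ^ 2 * (p * n) := by gcongr
      have h6 : Cm ^ 2 * p * 1 ≤ Cm ^ 2 * p * n := by gcongr; linarith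
      nlinarith [sq_nonneg (‖sampleMean R X k‖ - ‖m k‖)]
    calc q * ‖sampleMean R X k - m k‖ ^ 2 ≤ 1 / (n : ℝ) ^ 3 * (34 * Cm ^ 2 * p * n) := by gcongr
      _ = 34 * Cm ^ 2 * p / n * (1 / n) := by field_simp
      _ ≤ 34 * Cm ^ 2 * p / n := by
          refine mul_le_of_le_one_right (by positivity) ?_
          rw [div_le_one hn0]; linarith
      _ ≤ _ := le_add_of_nonneg_left (by positivity)
  · have hcard : c₀ * n ≤ (classIndices X k).card := by
      linarith [card_gt_of_bayesSubDist_pos hpos k]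
    have hcn : 0 < c₀ * n := by positivity
    have hN : (0 : ℝ) < (classIndices X k).card := hcn.trans_le hcard
    have he : sampleMean R X k - m k =
        ((classIndices X k).card : ℝ)⁻¹ •
          ∑ j ∈ classIndices X k, (ballProj R (X j).1 - m k) := by
      rw [Finset.sum_sub_distrib, smul_sub, Finset.sum_const, ← Nat.cast_smul_eq_nsmul ℝ,
        inv_smul_smul₀ hN.ne']
      rfl
    rw [he, norm_smul, mul_pow, norm_inv, Real.norm_of_nonneg hN.le, ← hV, inv_pow, ← one_div]
    calc q * (1 / ((classIndices X k).card : ℝ) ^ 2 * V ^ 2)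
        ≤ 1 * (1 / (c₀ * n) ^ 2 * V ^ 2) := by gcongr
      _ ≤ _ := by rw [one_mul]; exact le_add_of_nonneg_right (by positivity)

theorem lintegral_bayesSqError_bayesEPTR_le (hc₀ : 0 < c₀) (hμ : ∀ k, 2 * c₀ < μ k)
    (hs : ∑ k, μ k = 1) {bot : Measure (BayesParam K p)} [IsProbabilityMeasure bot] {B : ℝ}
    (hB0 : 0 ≤ B) (hB : ∀ᵐ t ∂bot, bayesSqError μ m t ≤ B) (X : Fin n → LabelledPoint K p) :
    ∫⁻ t, ENNReal.ofReal (bayesSqError μ m t) ∂(bayesEPTR ε δ R c₀ bot X) ≤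
      ENNReal.ofReal ((1 + 2 / c₀ ^ 2 * (1 + 1 / c₀)) *
        (ePTRReleaseProb ε δ (bayesSubDist c₀ X) *
          (2 * bayesSqError μ m (bayesParam (sampleFreq X) (sampleMean R X)) +
            2 * (2 * bayesSensitivity n R c₀ / ε * Real.sqrt (2 * Real.log (1.25 / δ))) ^ 2 *
              (K + K * p)) +
          (1 - ePTRReleaseProb ε δ (bayesSubDist c₀ X)) * B)) := by
  set q := ePTRReleaseProb ε δ (bayesSubDist c₀ X) with hq
  have hq0 : 0 < q := ePTRReleaseProb_pos _ _ _
  have hq1 : 0 < 1 - q := one_sub_ePTRReleaseProb_pos _ _ _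
  set L := 1 + 2 / c₀ ^ 2 * (1 + 1 / c₀) with hL
  have hL0 : 0 < L := by positivity
  set θ := bayesParam (sampleFreq X) (sampleMean R X)
  have hθ := bayesSqError_nonneg μ m θ
  have hrel := lintegral_norm_sub_sq_gaussianRelease_le ε δ (bayesSensitivity n R c₀) θ
    (bayesParam μ m)
  simp_rw [norm_sub_bayesParam_sq, finrank_bayesParam] at hrel
  have hbot : ∫⁻ t, ENNReal.ofReal (bayesSqError μ m t) ∂bot ≤ ENNReal.ofReal B := by
    calc _ ≤ ∫⁻ _, ENNReal.ofReal B ∂bot :=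
          lintegral_mono_ae (hB.mono fun t ht => ENNReal.ofReal_le_ofReal ht)
      _ = _ := by simp
  set W := 2 * bayesSqError μ m θ + 2 * (2 * bayesSensitivity n R c₀ / ε *
    Real.sqrt (2 * Real.log (1.25 / δ))) ^ 2 * (K + K * p)
  have hW : 0 ≤ W := by positivity
  rw [bayesEPTR]
  refine (lintegral_map_le (fun t => ENNReal.ofReal (bayesSqError μ m t)) (bayesAugment c₀)).trans ?_
  calc ∫⁻ t, ENNReal.ofReal (bayesSqError μ m (bayesAugment c₀ t))
          ∂(ePTRLaw ε δ (bayesSensitivity n R c₀) bot θ (bayesSubDist c₀ X))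
      ≤ ∫⁻ t, ENNReal.ofReal L * ENNReal.ofReal (bayesSqError μ m t)
          ∂(ePTRLaw ε δ (bayesSensitivity n R c₀) bot θ (bayesSubDist c₀ X)) := by
        refine lintegral_mono fun t => ?_
        rw [← ENNReal.ofReal_mul hL0.le]
        exact ENNReal.ofReal_le_ofReal (bayesSqError_bayesAugment_le hc₀ hμ hs t)
    _ = ENNReal.ofReal L * (ENNReal.ofReal q * ∫⁻ t, ENNReal.ofReal (bayesSqError μ m t)
            ∂(gaussianRelease ε δ (bayesSensitivity n R c₀) θ) +
          ENNReal.ofReal (1 - q) * ∫⁻ t, ENNReal.ofReal (bayesSqError μ m t) ∂bot) := by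
        rw [lintegral_const_mul _ (measurable_bayesSqError μ m).ennreal_ofReal, ePTRLaw,
          lintegral_add_measure, lintegral_smul_measure, lintegral_smul_measure]
        rfl
    _ ≤ ENNReal.ofReal L *
          (ENNReal.ofReal q * ENNReal.ofReal W + ENNReal.ofReal (1 - q) * ENNReal.ofReal B) := by
        gcongr
    _ = _ := by
        rw [← ENNReal.ofReal_mul hq0.le, ← ENNReal.ofReal_mul hq1.le,
          ← ENNReal.ofReal_add (by positivity) (by positivity), ← ENNReal.ofReal_mul hL0.le]

/-- `T` stands for the noise and `B` for the fallback error. The bound is affine in the two squared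
statistics, so it can be integrated term by term. -/
theorem conditional_risk_le (hc₀ : 0 < c₀) (hε : 0 < ε) (hδ : 0 < δ) (hδε : δ ≤ ε)
    (hn8 : 8 ≤ n) (hδn : δ ≤ 1 / (n : ℝ) ^ 3)
    (hn : 4 + 8 / ε * Real.log (1 / δ) ≤ c₀ * n) (hμ : ∀ k, 2 * c₀ < μ k)
    (hs : ∑ k, μ k = 1) (hm : ∀ k, ‖m k‖ ≤ Cm * Real.sqrt p)
    (hR0 : 0 ≤ R) (hR : R ^ 2 = 16 * Cm ^ 2 * (p * Real.log n)) {B T : ℝ} (hB : 0 ≤ B)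
    (hT : 0 ≤ T) (X : Fin n → LabelledPoint K p) :
    ePTRReleaseProb ε δ (bayesSubDist c₀ X) *
          (2 * bayesSqError μ m (bayesParam (sampleFreq X) (sampleMean R X)) + T) +
        (1 - ePTRReleaseProb ε δ (bayesSubDist c₀ X)) * B ≤
      (2 / n ^ 2 + 4 * B / (c₀ * n) ^ 2) * ∑ k, ((classIndices X k).card - n * μ k) ^ 2 +
        2 / (c₀ * n) ^ 2 *
          ∑ k, ‖∑ j ∈ classIndices X k, (ballProj R (X j).1 - m k)‖ ^ 2 +
        (68 * K * Cm ^ 2 * p / n + T + B / n) := by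
  have hnr : (8 : ℝ) ≤ n := by exact_mod_cast hn8
  have hn0 : (0 : ℝ) < n := by linarith
  have hδ1 : δ ≤ 1 / n := by
    refine hδn.trans (one_div_le_one_div_of_le hn0 (le_self_pow₀ (by linarith) (by norm_num)))
  have h1 := one_sub_releaseProb_le hε hδ hδε hδ1 hn hμ hs X
  have h2 := fun k => releaseProb_mul_norm_sampleMean_sub_sq_le hc₀ hε hδ hn8 hδn (hm k) hR0 hR X
  set q := ePTRReleaseProb ε δ (bayesSubDist c₀ X) with hq
  have hq0 : 0 < q := ePTRReleaseProb_pos _ _ _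
  have hq1 : q ≤ 1 := by linarith [one_sub_ePTRReleaseProb_pos ε δ (bayesSubDist c₀ X)]
  have hfreq : ∀ k, |sampleFreq X k - μ k| ^ 2 =
      1 / n ^ 2 * ((classIndices X k).card - n * μ k) ^ 2 := fun k => by
    rw [sq_abs, sampleFreq]; field_simp
  have herr : q * bayesSqError μ m (bayesParam (sampleFreq X) (sampleMean R X)) ≤
      1 / n ^ 2 * ∑ k, ((classIndices X k).card - n * μ k) ^ 2 +
        (1 / (c₀ * n) ^ 2 *
          ∑ k, ‖∑ j ∈ classIndices X k, (ballProj R (X j).1 - m k)‖ ^ 2 +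
        K * (34 * Cm ^ 2 * p / n)) := by
    have he : bayesSqError μ m (bayesParam (sampleFreq X) (sampleMean R X)) =
        1 / n ^ 2 * ∑ k, ((classIndices X k).card - n * μ k) ^ 2 +
          ∑ k, ‖sampleMean R X k - m k‖ ^ 2 := by
      rw [Finset.mul_sum, ← Finset.sum_add_distrib]
      exact Finset.sum_congr rfl fun k _ => by rw [← hfreq]; rfl
    rw [he, mul_add]
    refine add_le_add (mul_le_of_le_one_left (by positivity) hq1) ?_
    rw [Finset.mul_sum]
    refine (Finset.sum_le_sum fun k _ => h2 k).trans_eq ?_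
    rw [Finset.sum_add_distrib, ← Finset.mul_sum]
    simp
  have h3 : q * T ≤ T := mul_le_of_le_one_left hT hq1
  have h4 := mul_le_mul_of_nonneg_right h1 hB
  calc _ = 2 * (q * bayesSqError μ m (bayesParam (sampleFreq X) (sampleMean R X))) + q * T +
        (1 - q) * B := by ring
    _ ≤ 2 * _ + T + _ := add_le_add (add_le_add (mul_le_mul_of_nonneg_left herr two_pos.le) h3) h4
    _ = _ := by ring

/-- The constant in the risk bound of the ePTR Bayes classifier. -/
noncomputable def bayesRiskConst (c₀ Cm Cbot : ℝ) : ℝ :=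
  (1 + 2 / c₀ ^ 2 * (1 + 1 / c₀)) *
    (1 / c₀ * (2 + 4 * Cbot / c₀ ^ 2) + 2 / c₀ * (27 + 8 * Cm ^ 2) / c₀ ^ 2 +
      68 / c₀ * Cm ^ 2 + Cbot + 256 / c₀ * (32 * Cm ^ 2 / c₀ ^ 2 + 2))

/-- Each term is at most a constant times `p / n` or times `Q`, by `K ≤ 1 / c₀` and `1 / n ≤ p / n`.
The constants are added, and the surplus cross terms are nonnegative. -/
theorem risk_sum_le_bayesRiskConst {K p n c₀ Cm Cbot T Q ID IV : ℝ} (hp1 : 1 ≤ p) (hn0 : 0 < n)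
    (hc₀ : 0 < c₀) (hCbot : 0 ≤ Cbot) (hK : K ≤ 1 / c₀) (hQ0 : 0 ≤ Q)
    (hDb : ID ≤ K * n) (hVb : IV ≤ K * (n * p * (27 + 8 * Cm ^ 2)))
    (hT : T ≤ 256 / c₀ * (32 * Cm ^ 2 / c₀ ^ 2 + 2) * Q) :
    (1 + 2 / c₀ ^ 2 * (1 + 1 / c₀)) *
      ((2 / n ^ 2 + 4 * (Cbot * p) / (c₀ * n) ^ 2) * ID + 2 / (c₀ * n) ^ 2 * IV +
        (68 * K * Cm ^ 2 * p / n + T + Cbot * p / n)) ≤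
      bayesRiskConst c₀ Cm Cbot * (p / n + Q) := by
  have hL0 : 0 ≤ 1 + 2 / c₀ ^ 2 * (1 + 1 / c₀) := by positivity
  rw [bayesRiskConst, mul_assoc (1 + 2 / c₀ ^ 2 * (1 + 1 / c₀)) _ (p / n + Q)]
  refine mul_le_mul_of_nonneg_left ?_ hL0
  set r := p / n with hr
  have hr0 : 0 ≤ r := by positivity
  have e1 : (2 / n ^ 2 + 4 * (Cbot * p) / (c₀ * n) ^ 2) * ID ≤
      1 / c₀ * (2 + 4 * Cbot / c₀ ^ 2) * r := by
    calc (2 / n ^ 2 + 4 * (Cbot * p) / (c₀ * n) ^ 2) * ID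
        ≤ (2 / n ^ 2 + 4 * (Cbot * p) / (c₀ * n) ^ 2) * (1 / c₀ * n) :=
          mul_le_mul_of_nonneg_left (hDb.trans (by gcongr)) (by positivity)
      _ = 1 / c₀ * (2 * (1 / n) + 4 * Cbot / c₀ ^ 2 * r) := by
          rw [hr]; field_simp
      _ ≤ 1 / c₀ * (2 * r + 4 * Cbot / c₀ ^ 2 * r) := by
          rw [hr]; gcongr
      _ = _ := by ring
  have e2 : 2 / (c₀ * n) ^ 2 * IV ≤ 2 / c₀ * (27 + 8 * Cm ^ 2) / c₀ ^ 2 * r := by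
    calc 2 / (c₀ * n) ^ 2 * IV ≤ 2 / (c₀ * n) ^ 2 * (1 / c₀ * (n * p * (27 + 8 * Cm ^ 2))) :=
          mul_le_mul_of_nonneg_left (hVb.trans (by gcongr)) (by positivity)
      _ = _ := by rw [hr]; field_simp
  have e3 : 68 * K * Cm ^ 2 * p / n ≤ 68 / c₀ * Cm ^ 2 * r := by
    calc 68 * K * Cm ^ 2 * p / n = 68 * Cm ^ 2 * r * K := by rw [hr]; ring
      _ ≤ 68 * Cm ^ 2 * r * (1 / c₀) := by gcongr
      _ = _ := by ring
  have e5 : Cbot * p / n = Cbot * r := by rw [hr]; ring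
  set u := 1 / c₀ * (2 + 4 * Cbot / c₀ ^ 2)
  set v := 2 / c₀ * (27 + 8 * Cm ^ 2) / c₀ ^ 2
  set w := 68 / c₀ * Cm ^ 2
  set y := 256 / c₀ * (32 * Cm ^ 2 / c₀ ^ 2 + 2)
  have hu : 0 ≤ u * Q := by positivity
  have hv : 0 ≤ v * Q := by positivity
  have hw : 0 ≤ w * Q := by positivity
  have hb : 0 ≤ Cbot * Q := by positivity
  have hy : 0 ≤ y * r := by positivity
  have : (u + v + w + Cbot + y) * (r + Q) = u * r + v * r + w * r + Cbot * r + y * Q +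
      (u * Q + v * Q + w * Q + Cbot * Q + y * r) := by ring
  linarith

theorem bayesMSE_le {Cbot : ℝ} (hc₀ : 0 < c₀) (hCm : 1 ≤ Cm) (hCbot : 0 ≤ Cbot) (hp : 1 ≤ p)
    (hε : 0 < ε) (hδ : 0 < δ) (hs : ∑ k, μ k = 1) (hμ : ∀ k, 2 * c₀ < μ k)
    (hm : ∀ k, ‖m k‖ ≤ Cm * Real.sqrt p) {bot : Measure (BayesParam K p)}
    [IsProbabilityMeasure bot] (hbot : ∀ᵐ t ∂bot, bayesSqError μ m t ≤ Cbot * p)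
    (hδn : δ < 1 / (n : ℝ) ^ 3) (hn : 4 / c₀ + 8 / (c₀ * ε) * Real.log (1 / δ) ≤ n) :
    bayesMSE n ε δ (4 * Cm * Real.sqrt (p * |Real.log n|)) c₀ bot μ m ≤
      ENNReal.ofReal (bayesRiskConst c₀ Cm Cbot * (p / n +
        p ^ 2 * Real.log n * Real.log (1 / δ) / (ε ^ 2 * n ^ 2))) := by
  obtain ⟨k₀⟩ := nonempty_of_sum_eq_one hs
  have hμ0 : ∀ k, 0 ≤ μ k := fun k => by linarith [hμ k]
  have hK : (K : ℝ) ≤ 1 / c₀ := by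
    rw [le_div_iff₀ hc₀]; linarith [card_mul_le_one hμ hs]
  have hc₁ : c₀ ≤ 1 / 2 := by linarith [hμ k₀, le_one_of_sum_eq_one hμ0 hs k₀]
  obtain ⟨hn8, hδn', hlog, hδε, hn'⟩ := sample_size_bounds hc₀ hc₁ hε hδ hδn hn
  have := isProbabilityMeasure_bayesPointLaw (m := m) hμ0 hs
  have hlogn := two_le_log_of_eight_le hn8
  have hn0 : (0 : ℝ) < n := by exact_mod_cast (by omega : 0 < n)
  have hp1 : (1 : ℝ) ≤ p := by exact_mod_cast hp
  set R := 4 * Cm * Real.sqrt (p * |Real.log n|) with hRdef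
  have hR0 : 0 ≤ R := by positivity
  have hR2 : R ^ 2 = 16 * Cm ^ 2 * (p * Real.log n) := by
    rw [hRdef, mul_pow, abs_of_nonneg (by linarith), Real.sq_sqrt (by positivity)]; ring
  set s := 2 * bayesSensitivity n R c₀ / ε * Real.sqrt (2 * Real.log (1.25 / δ)) with hsdef
  have hs2 : s ^ 2 ≤ _ := noise_scale_sq_le hp hn8 hc₀ hε hδ hδn' hR2
  set L := 1 + 2 / c₀ ^ 2 * (1 + 1 / c₀) with hL
  have hL0 : 0 < L := by positivity
  set T := 2 * s ^ 2 * (K + K * p) with hT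
  set B := Cbot * p with hB
  have hB0 : 0 ≤ B := by positivity
  set a := 2 / (n : ℝ) ^ 2 + 4 * B / (c₀ * n) ^ 2 with ha
  set b := 2 / (c₀ * n) ^ 2 with hb
  set c := 68 * K * Cm ^ 2 * p / n + T + B / n with hc
  set P := Measure.pi fun _ : Fin n => bayesPointLaw μ m
  have hD := fun k => integral_card_classIndices_sub_sq_le (n := n) (m := m) hμ0 hs k
  have hV := fun k => integral_norm_sum_classIndices_sq_le (R := R) hμ0 hs hp hn8 hCm k (hm k) hRdef
  have hDi := integrable_finsetSum Finset.univ fun k _ => (hD k).1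
  have hVi := integrable_finsetSum Finset.univ fun k _ => (hV k).1
  set D : (Fin n → LabelledPoint K p) → ℝ := fun X =>
    ∑ k, ((classIndices X k).card - n * μ k) ^ 2
  set V : (Fin n → LabelledPoint K p) → ℝ := fun X =>
    ∑ k, ‖∑ j ∈ classIndices X k, (ballProj R (X j).1 - m k)‖ ^ 2
  have hDb : ∫ X, D X ∂P ≤ K * n := by
    rw [integral_finsetSum _ fun k _ => (hD k).1]
    refine (Finset.sum_le_sum fun k _ => (hD k).2).trans_eq ?_
    simp
  have hVb : ∫ X, V X ∂P ≤ K * (n * p * (27 + 8 * Cm ^ 2)) := by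
    rw [integral_finsetSum _ fun k _ => (hV k).1]
    refine (Finset.sum_le_sum fun k _ => (hV k).2).trans_eq ?_
    simp
  have hab : Integrable (fun X => a * D X + b * V X) P := (hDi.const_mul a).add (hVi.const_mul b)
  have hgi : Integrable (fun X => L * (a * D X + b * V X + c)) P :=
    (hab.add (integrable_const c)).const_mul L
  have hgv : ∫ X, L * (a * D X + b * V X + c) ∂P =
      L * (a * ∫ X, D X ∂P + b * ∫ X, V X ∂P + c) := by
    rw [integral_const_mul, integral_add hab (integrable_const c), integral_add (hDi.const_mul a) (hVi.const_mul b), integral_const_mul,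
      integral_const_mul]
    simp [P]
  have ha0 : 0 ≤ a := by positivity
  have hb0 : 0 ≤ b := by positivity
  have hT0 : 0 ≤ T := by positivity
  have hc0 : 0 ≤ c := by positivity
  have hg0 : ∀ X, 0 ≤ L * (a * D X + b * V X + c) := fun X => by
    have : 0 ≤ D X := Finset.sum_nonneg fun _ _ => sq_nonneg _
    have : 0 ≤ V X := Finset.sum_nonneg fun _ _ => sq_nonneg _
    positivity
  calc bayesMSE n ε δ R c₀ bot μ m ≤ ∫⁻ X, ENNReal.ofReal (L * (a * D X + b * V X + c)) ∂P := by
        -- This needs no measurability of the conditional risk in `X`; only the majorant has to be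
        -- integrable.
        refine lintegral_mono fun X => ?_
        refine (lintegral_bayesSqError_bayesEPTR_le hc₀ hμ hs hB0 hbot X).trans
          (ENNReal.ofReal_le_ofReal (mul_le_mul_of_nonneg_left ?_ hL0.le))
        exact conditional_risk_le hc₀ hε hδ hδε hn8 hδn' hn' hμ hs hm hR0 hR2 hB0 hT0 X
    _ = ENNReal.ofReal (L * (a * ∫ X, D X ∂P + b * ∫ X, V X ∂P + c)) := by
        rw [← hgv, ofReal_integral_eq_lintegral_ofReal hgi (Filter.Eventually.of_forall hg0)]
    _ ≤ _ := ENNReal.ofReal_le_ofReal ?_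
  refine risk_sum_le_bayesRiskConst hp1 hn0 hc₀ hCbot hK (by positivity) hDb hVb ?_
  -- The dimension `K + K p` is at most `2 p / c₀`; this factor `p` turns the noise variance into
  -- the `p²` rate.
  calc T ≤ 2 * (64 * (32 * Cm ^ 2 / c₀ ^ 2 + 2) *
        (p * Real.log n * Real.log (1 / δ) / (ε ^ 2 * n ^ 2))) *
          (1 / c₀ * p + 1 / c₀ * p) := by
        rw [hT]
        have : (K : ℝ) ≤ 1 / c₀ * p := hK.trans (le_mul_of_one_le_right (by positivity) hp1)
        gcongr
    _ = _ := by ring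

end Risk

theorem mainTheorem4 :
    (∀ (K p n : ℕ) (ε δ R c₀ : ℝ) (bot : MeasureTheory.Measure (BayesParam K p)),
      0 < ε → ε ≤ 2 → 0 < δ → 0 ≤ R → 0 < c₀ → MeasureTheory.IsProbabilityMeasure bot →
      IsDP ε δ (bayesEPTR (n := n) ε δ R c₀ bot)) ∧
    (∀ c₀ Cm Cbot : ℝ, 0 < c₀ → 1 ≤ Cm → 0 ≤ Cbot →
      ∃ C : ℝ, 0 < C ∧
        ∀ (K p n : ℕ) (ε δ : ℝ) (μ : Fin K → ℝ) (m : Fin K → EuclideanSpace ℝ (Fin p))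
          (bot : MeasureTheory.Measure (BayesParam K p)),
          1 ≤ p → 0 < ε → 0 < δ → ∑ k, μ k = 1 →
          (∀ k, 2 * c₀ < μ k) →
          (∀ k, ‖m k‖ ≤ Cm * Real.sqrt p) →
          MeasureTheory.IsProbabilityMeasure bot →
          (∀ᵐ t ∂bot, bayesSqError μ m t ≤ Cbot * p) →
          δ < 1 / (n : ℝ) ^ 3 →
          4 / c₀ + 8 / (c₀ * ε) * Real.log (1 / δ) ≤ n →
          bayesMSE n ε δ (4 * Cm * Real.sqrt (p * |Real.log n|)) c₀ bot μ m ≤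
            ENNReal.ofReal (C * (p / n +
              p ^ 2 * Real.log n * Real.log (1 / δ) / (ε ^ 2 * n ^ 2)))) := by
  refine ⟨fun K p n ε δ R c₀ bot hε hε2 hδ hR hc₀ _ => isDP_bayesEPTR bot hε hε2 hδ hR hc₀,
    fun c₀ Cm Cbot hc₀ hCm hCbot => ⟨bayesRiskConst c₀ Cm Cbot, ?_, ?_⟩⟩
  · unfold bayesRiskConst
    positivity
  · intro K p n ε δ μ m bot hp hε hδ hs hμ hm _ hbot hδn hn
    exact bayesMSE_le hc₀ hCm hCbot hp hε hδ hs hμ hm hbot hδn hn
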